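/- Let $a,\lambda\in\mathbb{C}$ and let $k\ge 1$ be an integer. Let $M_a(1)$ be the rank one Heisenberg vertex operator algebra, with underlying space $M(1)=\mathbb{C}[\alpha_{-1},\alpha_{-2},\dots]\mathbf 1$, conformal vector $\omega^a=\frac12\alpha_{-1}^2\mathbf 1+a\,\alpha_{-2}\mathbf 1$ and central charge $c=1-12a^2$. Let $W=W(a,\lambda,k)=M_a(1)\otimes\Omega(\lambda,k)$ be the $M_a(1)$-module induced from $\Omega(\lambda,k)=\mathbb{C}[x]/((x-\lambda)^k)$, on which $\alpha_0$ acts as multiplication by $x$ and $\alpha_n$, $n>0$, acts by zero. Let $u_j=(x-\lambda)^{k-j}$ for $1\le j\le k$, let $W^{(j)}$ be the submodule of $W$ generated by $u_1,\dots,u_j$ (with $W^{(0)}=0$), and for $\mu\in\mathbb{C}$ let $W_\mu$ be the generalized $\mu$-eigenspace of $L_0=\omega^a_1$, with $L_0|_{W_\mu}=\mu+(L_0^N)_\mu$. For $v\in M_a(1)$ let $o(v)$ denote its zero mode ($o(v)=v_{\mathrm{wt}\,v-1}$ for homogeneous $v$, extended linearly). A strongly interlocked basis of $W_\mu$ is a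 basis $B_{1,1},\dots,B_{1,d},\dots,B_{k,1},\dots,B_{k,d}$ such that (i) for every $j$ the first $j$ blocks span $W^{(j)}\cap W_\mu$; (ii) every operator $\sigma$ in the algebra generated by the zero modes restricted to $W_\mu$ has a block upper triangular matrix $(\sigma_{ij})_{1\le i,j\le k}$, with $d\times d$ blocks, such that $\sigma_{ii}=\sigma_{11}$ and $\sigma_{1j}=\sigma_{k+1-j,\,k}$ for all $i,j$; and (iii) it is normalized by the Jordan form of $\alpha_0$, that is, $(\alpha_0-\lambda)B_{j,s}=B_{j-1,s}$ for $j>1$ and $(\alpha_0-\lambda)B_{1,s}=0$. The pseudo-trace $\mathrm{pstr}(\sigma)$ of an operator $\sigma$ on $W_\mu$ is the trace of the upper right block $\sigma_{1k}$ of its matrix in such a basis. For $\tau$ in the upper half plane put $q^s=e^{2\pi i\tau s}$ for $s\in\mathbb{C}$, and $\log q=2\pi i\tau$; the graded pseudo-trace of $W$ associated with $v$ is $$\mathrm{pstr}_W(v,\tau)=\sum_{\mu\in\mathbb{C}}\sum_{j\ge0}\mathrm{pstr}\Big(o(v)|_{W_\mu}\tfrac1{j!}(L_0^N)_\mu^j(\log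 q)^j\Big)q^{\mu-c/24}.$$ Then strongly interlocked bases exist for all $\mu$, and for every choice of them and every $\tau$ in the upper half plane the series for $v=\mathbf 1$ converges absolutely and $$\mathrm{pstr}_W(\mathbf 1,\tau)=q^{\frac12(\lambda-a)^2-\frac1{24}}\sum_{\ell\ge0}q^\ell\,\mathfrak p(\ell)\Bigg(\sum_{j=\lceil\frac{k-1}2\rceil}^{k-1}\frac1{j!}\binom{j}{k-j-1}2^{-k+j+1}(\lambda-a)^{2j-k+1}(\log q)^j\Bigg)$$ $$=q^{\frac12(\lambda-a)^2}\,\eta(q)^{-1}\Bigg(\sum_{j=\lceil\frac{k-1}2\rceil}^{k-1}\frac1{j!}\binom{j}{k-j-1}2^{-k+j+1}(\lambda-a)^{2j-k+1}(\log q)^j\Bigg),$$ where the series over $\ell$ converges absolutely, $\mathfrak p(\ell)$ is the number of partitions of $\ell$, $\eta(q)=q^{1/24}\prod_{n\ge1}(1-q^n)$, and $0^0=1$. -/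

import Mathlib

noncomputable section

namespace FreeBoson

open VertexOperator TensorProduct

variable {W : Type*} [AddCommGroup W] [Module ℂ W]

/-- The modes of a vertex operator eventually annihilate any given vector. -/
theorem exists_bound (A : VertexOperator ℂ W) (w : W) :
    ∃ N : ℤ, ∀ m : ℤ, N ≤ m → ncoeff A m w = 0 := by
  refine ⟨-((HahnModule.of ℂ).symm (A w)).order, fun m hm => ?_⟩
  exact ncoeff_eq_zero_of_lt_order A m w (by lia)

/-- The `i`-th term of the `m`-th mode of the `n`-th product `A₍ₙ₎B`. -/
def nthProdTerm (n : ℤ) (A B : VertexOperator ℂ W) (m : ℤ) (i : ℕ) : Module.End ℂ W :=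
  ((-1 : ℂ) ^ i * ((Ring.choose n i : ℤ) : ℂ)) •
    (ncoeff A (n - i) * ncoeff B (m + i) - (-1 : ℂ) ^ n • (ncoeff B (n + m - i) * ncoeff A i))

theorem nthProdTerm_support (n : ℤ) (A B : VertexOperator ℂ W) (m : ℤ) (w : W) :
    (Function.support fun i => nthProdTerm n A B m i w).Finite := by
  obtain ⟨N, hN⟩ := exists_bound A w
  obtain ⟨M, hM⟩ := exists_bound B w
  refine (Set.finite_Iio (N.toNat + (M - m).toNat)).subset fun i hi => ?_
  by_contra h
  have h' : N.toNat + (M - m).toNat ≤ i := by simpa using h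
  apply hi
  simp [nthProdTerm, hN i (by lia), hM (m + i) (by lia)]

/-- The `m`-th mode of the `n`-th product: a locally finite sum of operators. -/
def nthProdMode (n : ℤ) (A B : VertexOperator ℂ W) (m : ℤ) : Module.End ℂ W where
  toFun w := ∑ᶠ i : ℕ, nthProdTerm n A B m i w
  map_add' v w := by
    simp only [map_add]
    exact finsum_add_distrib (nthProdTerm_support n A B m v) (nthProdTerm_support n A B m w)
  map_smul' c w := by
    simp only [map_smul, RingHom.id_apply]
    exact (smul_finsum' c (nthProdTerm_support n A B m w)).symm

theorem nthProdMode_bound (n : ℤ) (A B : VertexOperator ℂ W) (w : W) :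
    ∃ N : ℤ, ∀ m : ℤ, N ≤ m → nthProdMode n A B m w = 0 := by
  obtain ⟨K, hK⟩ := exists_bound A w
  obtain ⟨M, hM⟩ := exists_bound B w
  choose f hf using fun i : ℕ => exists_bound B (ncoeff A i w)
  refine ⟨max M (∑ i ∈ Finset.range K.toNat, (|f i| + i) + |n|), fun m hm => ?_⟩
  refine finsum_eq_zero_of_forall_eq_zero fun i => ?_
  have h1 : ncoeff B (m + i) w = 0 := hM _ (by have := le_max_left M (∑ i ∈ Finset.range K.toNat, (|f i| + i) + |n|); lia)
  have h2 : ncoeff B (n + m - i) (ncoeff A i w) = 0 := by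
    by_cases hi : i < K.toNat
    · apply hf
      have h3 : |f i| + (i : ℤ) ≤ ∑ i ∈ Finset.range K.toNat, (|f i| + (i : ℤ)) :=
        Finset.single_le_sum (f := fun i : ℕ => |f i| + (i : ℤ))
          (fun j _ => by positivity) (Finset.mem_range.2 hi)
      have h4 := (le_max_right _ _).trans hm
      have h5 := le_abs_self (f i)
      have h6 := neg_abs_le n
      lia
    · rw [hK i (by lia), map_zero]
  simp [nthProdTerm, h1, h2]

/-- The `n`-th product of vertex operators,
`(A₍ₙ₎B)ₘ = ∑_{i ≥ 0} (-1)^i C(n,i) (A_{n-i} B_{m+i} - (-1)^n B_{n+m-i} A_i)`;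
for `n = -1` it is the normally ordered product `:AB:`, and for `n = -1-j` it is
`:(∂^j A / j!) B:`. -/
def nthProd (n : ℤ) (A B : VertexOperator ℂ W) : VertexOperator ℂ W :=
  of_coeff (fun e => nthProdMode n A B (-e - 1)) fun w => by
    obtain ⟨N, hN⟩ := nthProdMode_bound n A B w
    refine ⟨-N - 1, fun e he => ?_⟩
    by_contra h
    exact he (hN _ (by lia))

/-- The identity field `1 = Id_W x^0`. -/
def idField : VertexOperator ℂ W :=
  of_coeff (fun e => if e = 0 then 1 else 0) fun w => by
    refine ⟨0, fun e he => ?_⟩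
    by_contra h
    exact he (by simp [show e ≠ 0 by lia])

/-- `A` is homogeneous of weight `Δ` for the energy operator `L`: `[L, Aₘ] = (Δ - m - 1) Aₘ`. -/
def IsHomogeneous (L : Module.End ℂ W) (Δ : ℤ) (A : VertexOperator ℂ W) : Prop :=
  ∀ m : ℤ, L * ncoeff A m = ncoeff A m * L + ((Δ - m - 1 : ℤ) : ℂ) • ncoeff A m

theorem ncoeff_nthProd (n : ℤ) (A B : VertexOperator ℂ W) (m : ℤ) :
    ncoeff (nthProd n A B) m = nthProdMode n A B m := by
  rw [nthProd, ncoeff_of_coeff]; congr 1; lia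

theorem ncoeff_idField (m : ℤ) :
    ncoeff (idField : VertexOperator ℂ W) m = if m = -1 then 1 else 0 := by
  refine (ncoeff_of_coeff _ _ m).trans ?_
  congr 1
  simp only [eq_iff_iff]; lia

theorem isHomogeneous_idField (L : Module.End ℂ W) : IsHomogeneous L 0 idField := by
  intro m
  rw [ncoeff_idField]
  split_ifs with h <;> simp [h]

theorem IsHomogeneous.nthProd {L : Module.End ℂ W} {Δ Δ' : ℤ} {A B : VertexOperator ℂ W}
    (hA : IsHomogeneous L Δ A) (hB : IsHomogeneous L Δ' B) (n : ℤ) :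
    IsHomogeneous L (Δ + Δ' - n - 1) (nthProd n A B) := by
  have hA' : ∀ m w, L (ncoeff A m w) = ncoeff A m (L w) + ((Δ - m - 1 : ℤ) : ℂ) • ncoeff A m w :=
    fun m w => LinearMap.congr_fun (hA m) w
  have hB' : ∀ m w, L (ncoeff B m w) = ncoeff B m (L w) + ((Δ' - m - 1 : ℤ) : ℂ) • ncoeff B m w :=
    fun m w => LinearMap.congr_fun (hB m) w
  intro m
  ext w
  rw [ncoeff_nthProd]
  simp only [Module.End.mul_apply, LinearMap.add_apply, LinearMap.smul_apply]
  change L (∑ᶠ i : ℕ, nthProdTerm n A B m i w) = (∑ᶠ i : ℕ, nthProdTerm n A B m i (L w)) +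
    _ • (∑ᶠ i : ℕ, nthProdTerm n A B m i w)
  have hs := nthProdTerm_support n A B m w
  rw [smul_finsum' _ hs, ← finsum_add_distrib (nthProdTerm_support n A B m (L w))
    (g := fun i => ((Δ + Δ' - n - 1 - m - 1 : ℤ) : ℂ) • nthProdTerm n A B m i w)
    (hs.subset (Function.support_const_smul_subset _ _)),
    ← LinearMap.toAddMonoidHom_coe, AddMonoidHom.map_finsum _ hs]
  refine finsum_congr fun i => ?_
  simp only [nthProdTerm, LinearMap.toAddMonoidHom_coe, LinearMap.smul_apply, LinearMap.sub_apply,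
    Module.End.mul_apply, map_smul, map_sub, hA', hB', map_add]
  push_cast
  module

/-- The Fock space `M(1) = S(ĥ⁻)`, with `X n` standing for `α_{-n}` and `1` for the vacuum. -/
abbrev Fock : Type := MvPolynomial ℕ+ ℂ

/-- `Ω(λ, k) = ℂ[x] / ((x - λ)^k)`. -/
abbrev Omega (lam : ℂ) (k : ℕ) : Type :=
  AdjoinRoot ((Polynomial.X - Polynomial.C lam) ^ k : Polynomial ℂ)

/-- The underlying space `M(1) ⊗ Ω(λ, k)` of `W(a, λ, k)`. -/
def FockModule (lam : ℂ) (k : ℕ) : Type := Fock ⊗[ℂ] Omega lam k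

instance (lam : ℂ) (k : ℕ) : AddCommGroup (FockModule lam k) :=
  inferInstanceAs (AddCommGroup (Fock ⊗[ℂ] Omega lam k))

instance (lam : ℂ) (k : ℕ) : Module ℂ (FockModule lam k) :=
  inferInstanceAs (Module ℂ (Fock ⊗[ℂ] Omega lam k))

/-- The identity map, from the tensor product to `FockModule`. -/
def toFock (lam : ℂ) (k : ℕ) : Fock ⊗[ℂ] Omega lam k ≃ₗ[ℂ] FockModule lam k :=
  LinearEquiv.refl ℂ (Fock ⊗[ℂ] Omega lam k)

/-- The level one action of the Heisenberg algebra on `M(1) ⊗ Ω(λ, k)`: `α_n = n ∂/∂α_{-n}` and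
`α_{-n}` is multiplication, for `n > 0`, and `α_0` is multiplication by `x` on `Ω(λ, k)`. -/
def alpha (lam : ℂ) (k : ℕ) : ℤ → Module.End ℂ (FockModule lam k)
  | Int.ofNat 0 => (toFock lam k).conj
      (LinearMap.lTensor Fock (LinearMap.mulLeft ℂ (AdjoinRoot.root _)))
  | Int.ofNat (n + 1) => (toFock lam k).conj (LinearMap.rTensor (Omega lam k)
      (((n + 1 : ℕ) : ℂ) • (MvPolynomial.pderiv n.succPNat).toLinearMap))
  | Int.negSucc n => (toFock lam k).conj (LinearMap.rTensor (Omega lam k)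
      (LinearMap.mulLeft ℂ (MvPolynomial.X n.succPNat)))

theorem alpha_zero_tmul (lam : ℂ) (k : ℕ) (p : Fock) (u : Omega lam k) :
    alpha lam k (Int.ofNat 0) (toFock lam k (p ⊗ₜ u)) =
      toFock lam k (p ⊗ₜ (AdjoinRoot.root _ * u)) := by
  simp [alpha, LinearEquiv.conj_apply]

theorem alpha_pos_tmul (lam : ℂ) (k n : ℕ) (p : Fock) (u : Omega lam k) :
    alpha lam k (Int.ofNat (n + 1)) (toFock lam k (p ⊗ₜ u)) =
      ((n + 1 : ℕ) : ℂ) • toFock lam k (MvPolynomial.pderiv n.succPNat p ⊗ₜ u) := by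
  simp [alpha, LinearEquiv.conj_apply]

theorem alpha_neg_tmul (lam : ℂ) (k n : ℕ) (p : Fock) (u : Omega lam k) :
    alpha lam k (Int.negSucc n) (toFock lam k (p ⊗ₜ u)) =
      toFock lam k ((MvPolynomial.X n.succPNat * p) ⊗ₜ u) := by
  simp [alpha, LinearEquiv.conj_apply]

theorem FockModule.induction {lam : ℂ} {k : ℕ} {P : FockModule lam k → Prop}
    (w : FockModule lam k) (h0 : P 0) (h1 : ∀ p u, P (toFock lam k (p ⊗ₜ u)))
    (h2 : ∀ v w, P v → P w → P (v + w)) : P w :=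
  TensorProduct.induction_on w h0 h1 h2

theorem alpha_bound (lam : ℂ) (k : ℕ) (w : FockModule lam k) :
    ∃ N : ℤ, ∀ m : ℤ, N ≤ m → alpha lam k m w = 0 := by
  refine FockModule.induction
    (P := fun w => ∃ N : ℤ, ∀ m : ℤ, N ≤ m → alpha lam k m w = 0) w ⟨0, fun m _ => map_zero _⟩ (fun p u => ?_)
    fun v w hv hw => ?_
  · refine ⟨1 + ∑ i ∈ p.vars, ((i : ℕ) : ℤ), fun m hm => ?_⟩
    have h0 : (0 : ℤ) ≤ ∑ i ∈ p.vars, ((i : ℕ) : ℤ) := Finset.sum_nonneg fun _ _ => by positivity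
    obtain ⟨n, rfl⟩ : ∃ n : ℕ, m = Int.ofNat (n + 1) :=
      ⟨(m - 1).toNat, by simp only [Int.ofNat_eq_natCast]; lia⟩
    have hn : n.succPNat ∉ p.vars := fun h => by
      have := Finset.single_le_sum (f := fun i : ℕ+ => ((i : ℕ) : ℤ))
        (fun _ _ => by positivity) h
      simp only [Nat.succPNat_coe, Int.ofNat_eq_natCast] at this hm
      lia
    rw [alpha_pos_tmul, MvPolynomial.pderiv_eq_zero_of_notMem_vars hn, zero_tmul, map_zero,
      smul_zero]
  · obtain ⟨N, hN⟩ := hv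
    obtain ⟨M, hM⟩ := hw
    exact ⟨max N M, fun m hm => by rw [map_add, hN m (by lia), hM m (by lia), add_zero]⟩

/-- The commutation relations `[α_m, α_n] = m δ_{m+n,0}`. -/
theorem alpha_comm (lam : ℂ) (k : ℕ) (m n : ℤ) (w : FockModule lam k) :
    alpha lam k m (alpha lam k n w) =
      alpha lam k n (alpha lam k m w) + (if m + n = 0 then (m : ℂ) else 0) • w := by
  have hne : ∀ i j : ℕ, i ≠ j → j.succPNat ≠ i.succPNat := fun i j h h' =>
    h (Nat.succPNat_injective h').symm
  have hcomm : ∀ i j : ℕ, ∀ p : Fock, MvPolynomial.pderiv i.succPNat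
      (MvPolynomial.pderiv j.succPNat p) = MvPolynomial.pderiv j.succPNat
      (MvPolynomial.pderiv i.succPNat p) := fun i j p => by
    have h : ⁅(MvPolynomial.pderiv i.succPNat : Derivation ℂ Fock Fock),
        (MvPolynomial.pderiv j.succPNat : Derivation ℂ Fock Fock)⁆ = 0 := by
      refine MvPolynomial.derivation_ext fun l => ?_
      rw [Derivation.commutator_apply]
      simp [MvPolynomial.pderiv_X, Pi.single_apply, apply_ite]
    have h' := congrArg (fun D : Derivation ℂ Fock Fock => D p) h
    simpa [Derivation.commutator_apply, sub_eq_zero] using h'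
  refine FockModule.induction (P := fun w => alpha lam k m (alpha lam k n w) =
      alpha lam k n (alpha lam k m w) + (if m + n = 0 then (m : ℂ) else 0) • w) w (by simp) (fun p u => ?_) fun v w hv hw => ?_
  swap
  · simp only [map_add, hv, hw, smul_add]; abel
  rcases m with (_ | m) | m <;> rcases n with (_ | n) | n
  · simp
  · rw [if_neg (by simp only [Int.ofNat_eq_natCast]; lia), zero_smul, add_zero]
    simp only [alpha_zero_tmul, alpha_pos_tmul, map_smul]
  · rw [if_neg (by simp only [Int.ofNat_eq_natCast]; lia), zero_smul, add_zero]
    simp only [alpha_zero_tmul, alpha_neg_tmul]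
  · rw [if_neg (by simp only [Int.ofNat_eq_natCast]; lia), zero_smul, add_zero]
    simp only [alpha_zero_tmul, alpha_pos_tmul, map_smul]
  · rw [if_neg (by simp only [Int.ofNat_eq_natCast]; lia), zero_smul, add_zero]
    simp only [alpha_pos_tmul, map_smul, hcomm m n]
    rw [smul_comm]
  · simp only [alpha_pos_tmul, alpha_neg_tmul, map_smul, Derivation.leibniz, smul_eq_mul]
    by_cases h : m = n
    · subst h
      rw [if_pos (by simp only [Int.ofNat_eq_natCast]; lia), MvPolynomial.pderiv_X_self, mul_one,
        add_tmul, map_add, smul_add]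
      simp
    · rw [if_neg (by simp only [Int.ofNat_eq_natCast]; lia),
        MvPolynomial.pderiv_X_of_ne (hne m n h), mul_zero, add_zero, zero_smul, add_zero]
  · rw [if_neg (by simp only [Int.ofNat_eq_natCast]; lia), zero_smul, add_zero]
    simp only [alpha_zero_tmul, alpha_neg_tmul]
  · simp only [alpha_pos_tmul, alpha_neg_tmul, map_smul, Derivation.leibniz, smul_eq_mul]
    by_cases h : m = n
    · subst h
      rw [if_pos (by simp only [Int.ofNat_eq_natCast]; lia), MvPolynomial.pderiv_X_self, mul_one,
        add_tmul, map_add, smul_add, Int.negSucc_eq]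
      push_cast
      module
    · rw [if_neg (by simp only [Int.ofNat_eq_natCast]; lia),
        MvPolynomial.pderiv_X_of_ne (hne n m (Ne.symm h)), mul_zero, add_zero, zero_smul, add_zero]
  · rw [if_neg (by lia), zero_smul, add_zero]
    simp only [alpha_neg_tmul, mul_left_comm]

/-- The field `α(x) = ∑ α_n x^{-n-1}`. -/
def alphaField (lam : ℂ) (k : ℕ) : VertexOperator ℂ (FockModule lam k) :=
  of_coeff (fun e => alpha lam k (-e - 1)) fun w => by
    obtain ⟨N, hN⟩ := alpha_bound lam k w
    refine ⟨-N - 1, fun e he => ?_⟩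
    by_contra h
    exact he (hN _ (by lia))

/-- The vertex operator of `α_{-n₁} ⋯ α_{-nⱼ} 1`, by iterating
`Y(α_{-n} v, x) = α(x)₍₋ₙ₎ Y(v, x)` and `Y(1, x) = Id`. -/
def listField (lam : ℂ) (k : ℕ) (l : List ℕ+) : VertexOperator ℂ (FockModule lam k) :=
  l.foldr (fun (n : ℕ+) B => nthProd (-(n : ℤ)) (alphaField lam k) B) idField

/-- The vertex operator of the monomial with exponents `s`, written as
`α_{-n₁} ⋯ α_{-nⱼ} 1` with `n₁ ≥ ⋯ ≥ nⱼ`. -/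
def monomialField (lam : ℂ) (k : ℕ) (s : ℕ+ →₀ ℕ) : VertexOperator ℂ (FockModule lam k) :=
  listField lam k (s.toMultiset.sort (· ≥ ·))

/-- The state-field map `Y_W : M(1) → (End W)[[x, x⁻¹]]` of the `M(1)`-module
`W = M(1) ⊗ Ω(λ, k)`; the mode `v_m` is `ncoeff (Y lam k v) m`. -/
def Y (lam : ℂ) (k : ℕ) : Fock →ₗ[ℂ] VertexOperator ℂ (FockModule lam k) :=
  (MvPolynomial.basisMonomials ℕ+ ℂ).constr ℂ (monomialField lam k)

/-- The conformal vector `ω^a = ½ α_{-1}² 1 + a α_{-2} 1`. -/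
def conformalVector (a : ℂ) : Fock :=
  (1 / 2 : ℂ) • (MvPolynomial.X 1 * MvPolynomial.X 1) + a • MvPolynomial.X 2

/-- The central charge `c = 1 - 12 a²` of `M_a(1)`. -/
def centralCharge (a : ℂ) : ℂ := 1 - 12 * a ^ 2

/-- `L_0^a = ω^a_1` acting on `W(a, λ, k)`. -/
def L0 (a lam : ℂ) (k : ℕ) : Module.End ℂ (FockModule lam k) :=
  ncoeff (Y lam k (conformalVector a)) 1

/-- The weight `n₁ + ⋯ + nⱼ` of `α_{-n₁} ⋯ α_{-nⱼ} 1`. -/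
def monomialWeight (s : ℕ+ →₀ ℕ) : ℤ := (s.toMultiset.map fun n : ℕ+ => (n : ℤ)).sum

/-- The zero mode `o(v)`: `o(v) = v_{wt v - 1}` for homogeneous `v`, extended linearly. -/
def zeroMode (lam : ℂ) (k : ℕ) : Fock →ₗ[ℂ] Module.End ℂ (FockModule lam k) :=
  (MvPolynomial.basisMonomials ℕ+ ℂ).constr ℂ
    fun s => ncoeff (monomialField lam k s) (monomialWeight s - 1)

theorem ncoeff_alphaField (lam : ℂ) (k : ℕ) (m : ℤ) :
    ncoeff (alphaField lam k) m = alpha lam k m := by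
  refine (ncoeff_of_coeff _ _ m).trans ?_
  congr 1; lia

theorem Y_list (lam : ℂ) (k : ℕ) (s : ℕ+ →₀ ℕ) :
    Y lam k (MvPolynomial.monomial s 1) = monomialField lam k s := by
  have := (MvPolynomial.basisMonomials ℕ+ ℂ).constr_basis ℂ (monomialField lam k) s
  rwa [MvPolynomial.coe_basisMonomials] at this

theorem choose_neg_one (i : ℕ) : ((-1 : ℂ) ^ i * ((Ring.choose (-1 : ℤ) i : ℤ) : ℂ)) = 1 := by
  have h : Ring.choose (-1 : ℤ) i = (-1) ^ i := by
    rw [Ring.choose_neg, add_sub_cancel_left, Ring.choose_natCast, Nat.choose_self]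
    simp [Int.negOnePow_def, Units.smul_def]
  rw [h]
  push_cast
  rw [← mul_pow]
  norm_num

theorem nthProdTerm_neg_one {W : Type*} [AddCommGroup W] [Module ℂ W]
    (A B : VertexOperator ℂ W) (m : ℤ) (i : ℕ) (w : W) :
    nthProdTerm (-1) A B m i w = ncoeff A (-1 - i) (ncoeff B (m + i) w) +
      ncoeff B (m - 1 - i) (ncoeff A i w) := by
  rw [nthProdTerm, choose_neg_one, show (-1 : ℤ) + m - i = m - 1 - i by ring]
  simp

theorem nthProd_neg_one_idField {W : Type*} [AddCommGroup W] [Module ℂ W]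
    (A : VertexOperator ℂ W) (m : ℤ) : ncoeff (nthProd (-1) A idField) m = ncoeff A m := by
  refine LinearMap.ext fun w => ?_
  rw [ncoeff_nthProd]
  change (∑ᶠ i : ℕ, nthProdTerm (-1) A idField m i w) = _
  simp only [nthProdTerm_neg_one, ncoeff_idField]
  rcases le_or_gt 0 m with hm | hm
  · rw [finsum_eq_single _ m.toNat, if_neg (by lia), if_pos (by lia), LinearMap.zero_apply,
      map_zero, zero_add, Module.End.one_apply, Int.toNat_of_nonneg hm]
    intro i hi
    rw [if_neg (by lia), if_neg (by lia)]
    simp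
  · rw [finsum_eq_single _ (-1 - m).toNat, if_pos (by lia), if_neg (by lia),
      LinearMap.zero_apply, add_zero, Module.End.one_apply, Int.toNat_of_nonneg (by lia),
      sub_sub_cancel]
    intro i hi
    rw [if_neg (by lia), if_neg (by lia)]
    simp

theorem nthProd_neg_two_idField {W : Type*} [AddCommGroup W] [Module ℂ W]
    (A : VertexOperator ℂ W) : ncoeff (nthProd (-2) A idField) 1 = -ncoeff A 0 := by
  refine LinearMap.ext fun w => ?_
  rw [ncoeff_nthProd]
  change (∑ᶠ i : ℕ, nthProdTerm (-2) A idField 1 i w) = _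
  rw [finsum_eq_single _ 0]
  · simp [nthProdTerm, ncoeff_idField]
  · intro i hi
    rw [nthProdTerm, ncoeff_idField, ncoeff_idField, if_neg (by lia), if_neg (by lia)]
    simp

theorem L0_apply (a lam : ℂ) (k : ℕ) (w : FockModule lam k) :
    L0 a lam k w = (1 / 2 : ℂ) • (∑ᶠ i : ℕ, (alpha lam k (-1 - i) (alpha lam k (1 + i) w) +
      alpha lam k (-i) (alpha lam k i w))) - a • alpha lam k 0 w := by
  have h1 : (MvPolynomial.X 1 * MvPolynomial.X 1 : Fock) =
      MvPolynomial.monomial (Finsupp.single 1 1 + Finsupp.single 1 1) 1 := by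
    simp [MvPolynomial.X, MvPolynomial.monomial_mul]
  have h2 : (MvPolynomial.X 2 : Fock) = MvPolynomial.monomial (Finsupp.single 2 1) 1 := rfl
  have h3 : monomialField lam k (Finsupp.single 1 1 + Finsupp.single 1 1) =
      listField lam k [1, 1] := by
    rw [monomialField]
    congr 1
    simp only [map_add, Finsupp.toMultiset_single, one_smul]
    exact List.mergeSort_of_pairwise (le := fun a b : ℕ+ => decide (a ≥ b)) (by simp)
  have h4 : monomialField lam k (Finsupp.single 2 1) = listField lam k [2] := by
    rw [monomialField]
    congr 1
    simp [Finsupp.toMultiset_single]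
  have h5 : ncoeff (listField lam k [1, 1]) 1 w = ∑ᶠ i : ℕ,
      (alpha lam k (-1 - i) (alpha lam k (1 + i) w) + alpha lam k (-i) (alpha lam k i w)) := by
    change ncoeff (nthProd (-1) (alphaField lam k) (nthProd (-1) (alphaField lam k) idField)) 1 w
      = _
    rw [ncoeff_nthProd]
    change (∑ᶠ i : ℕ, nthProdTerm (-1) _ _ 1 i w) = _
    simp only [nthProdTerm_neg_one, nthProd_neg_one_idField, ncoeff_alphaField]
    simp
  have h6 : ncoeff (listField lam k [2]) 1 w = - alpha lam k 0 w := by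
    change ncoeff (nthProd (-2) (alphaField lam k) idField) 1 w = _
    rw [nthProd_neg_two_idField, ncoeff_alphaField]
    rfl
  rw [L0, conformalVector, map_add, map_smul, map_smul, h1, h2, Y_list, Y_list, h3, h4]
  simp only [map_add, map_smul, Pi.add_apply, Pi.smul_apply, LinearMap.add_apply,
    LinearMap.smul_apply, h5, h6]
  module

theorem isHomogeneous_alphaField (a lam : ℂ) (k : ℕ) :
    IsHomogeneous (L0 a lam k) 1 (alphaField lam k) := by
  have hs : ∀ w : FockModule lam k, (Function.support fun i : ℕ =>
      alpha lam k (-1 - i) (alpha lam k (1 + i) w) + alpha lam k (-i) (alpha lam k i w)).Finite := by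
    intro w
    obtain ⟨N, hN⟩ := alpha_bound lam k w
    refine (Set.finite_Iio N.toNat).subset fun i hi => ?_
    by_contra h
    have h' : N.toNat ≤ i := by simpa using h
    exact hi (by simp [hN i (by lia), hN (1 + i) (by lia)])
  intro p
  refine LinearMap.ext fun w => ?_
  simp only [ncoeff_alphaField, Module.End.mul_apply, LinearMap.add_apply, LinearMap.smul_apply]
  have hj : ∀ j : ℤ, alpha lam k (-j) (alpha lam k j (alpha lam k p w)) =
      alpha lam k p (alpha lam k (-j) (alpha lam k j w)) +
      ((if p = j then (-p : ℂ) else 0) + if p = -j then (-p : ℂ) else 0) • alpha lam k p w := by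
    intro j
    rw [alpha_comm lam k j p, map_add, map_smul, alpha_comm lam k (-j) p]
    by_cases h1 : p = j
    · subst h1
      by_cases h2 : p = 0
      · subst h2; simp
      · rw [if_pos (by lia), if_neg (by lia), if_pos rfl, if_neg (by lia)]
        push_cast
        module
    · by_cases h2 : p = -j
      · subst h2
        rw [if_neg (by lia), if_pos (by lia), if_neg h1, if_pos rfl]
        push_cast
        module
      · rw [if_neg (by lia), if_neg (by lia), if_neg h1, if_neg h2]
        module
  have hc : ∀ i : ℕ, alpha lam k (-1 - i) (alpha lam k (1 + i) (alpha lam k p w)) +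
      alpha lam k (-i) (alpha lam k i (alpha lam k p w)) =
      alpha lam k p (alpha lam k (-1 - i) (alpha lam k (1 + i) w) +
        alpha lam k (-i) (alpha lam k i w)) +
      ((if i + 1 = p.natAbs then (-p : ℂ) else 0) + if i = p.natAbs then (-p : ℂ) else 0) •
        alpha lam k p w := by
    intro i
    have h := hj (1 + i)
    rw [neg_add'] at h
    rw [h, hj i, map_add]
    have e1 : ((if p = 1 + (i : ℤ) then (-p : ℂ) else 0) +
        if p = -1 - (i : ℤ) then (-p : ℂ) else 0) = if i + 1 = p.natAbs then (-p : ℂ) else 0 := by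
      split_ifs <;> first | lia | simp
    have e2 : ((if p = (i : ℤ) then (-p : ℂ) else 0) +
        if p = -(i : ℤ) then (-p : ℂ) else 0) = if i = p.natAbs then (-p : ℂ) else 0 := by
      split_ifs with h1 h2
      all_goals first | lia | skip
      · obtain rfl : p = 0 := by lia
        simp
      · simp
      · simp
      · simp
    rw [e1, e2]
    module
  have hsub : (Function.support fun i : ℕ => ((if i + 1 = p.natAbs then (-p : ℂ) else 0) +
      if i = p.natAbs then (-p : ℂ) else 0) • alpha lam k p w) ⊆
      ↑(Finset.range (p.natAbs + 1)) := by
    intro i hi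
    by_contra h
    have h' : p.natAbs + 1 ≤ i := by simpa using h
    refine hi ?_
    change (_ + _ : ℂ) • _ = _
    rw [if_neg (by lia), if_neg (by lia), add_zero, zero_smul]
  have hd : (∑ᶠ i : ℕ, ((if i + 1 = p.natAbs then (-p : ℂ) else 0) +
      if i = p.natAbs then (-p : ℂ) else 0) • alpha lam k p w) = (-2 * p : ℂ) • alpha lam k p w := by
    rw [finsum_eq_sum_of_support_subset _ hsub, ← Finset.sum_smul, Finset.sum_add_distrib]
    congr 1
    rw [Finset.sum_ite_eq' (Finset.range (p.natAbs + 1)) p.natAbs, if_pos (by simp)]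
    rcases Nat.eq_zero_or_pos p.natAbs with h | h
    · obtain rfl : p = 0 := by lia
      simp
    · rw [Finset.sum_eq_single (p.natAbs - 1), if_pos (by lia)]
      · ring
      · intro i _ hi
        rw [if_neg (by lia)]
      · intro hi
        exact absurd (Finset.mem_range.2 (by lia)) hi
  rw [L0_apply, L0_apply, finsum_congr hc, finsum_add_distrib, hd, map_sub, map_smul, map_smul,
    ← LinearMap.toAddMonoidHom_coe (alpha lam k p), AddMonoidHom.map_finsum _ (hs w),
    LinearMap.toAddMonoidHom_coe, alpha_comm lam k 0 p]
  · have : (if 0 + p = 0 then ((0 : ℤ) : ℂ) else 0) = 0 := by simp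
    rw [this]
    push_cast
    module
  · refine (hs w).subset fun i hi h => hi ?_
    exact (congrArg (alpha lam k p) h).trans (map_zero _)
  · exact (Finset.finite_toSet _).subset hsub

theorem isHomogeneous_monomialField (a lam : ℂ) (k : ℕ) (s : ℕ+ →₀ ℕ) :
    IsHomogeneous (L0 a lam k) (monomialWeight s) (monomialField lam k s) := by
  have key : ∀ l : List ℕ+, IsHomogeneous (L0 a lam k) ((l.map fun n : ℕ+ => (n : ℤ)).sum)
      (listField lam k l) := by
    intro l
    induction l with
    | nil => exact isHomogeneous_idField _
    | cons n l ih =>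
      have := (isHomogeneous_alphaField a lam k).nthProd ih (-(n : ℤ))
      rw [show 1 + (l.map fun n : ℕ+ => (n : ℤ)).sum - -(n : ℤ) - 1 =
        ((n :: l).map fun n : ℕ+ => (n : ℤ)).sum by rw [List.map_cons, List.sum_cons]; ring] at this
      exact this
  have h := key (s.toMultiset.sort (· ≥ ·))
  rw [← Multiset.sum_coe, ← Multiset.map_coe, Multiset.sort_eq] at h
  exact h

/-- Zero modes commute with `L_0`, hence preserve the weight spaces. -/
theorem commute_zeroMode (a lam : ℂ) (k : ℕ) (v : Fock) :
    Commute (L0 a lam k) (zeroMode lam k v) := by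
  rw [zeroMode, Module.Basis.constr_apply]
  refine Commute.sum_right _ _ _ fun s _ => Commute.smul_right ?_ _
  have := isHomogeneous_monomialField a lam k s (monomialWeight s - 1)
  simpa [commute_iff_eq] using this

/-- The weight space `W_μ`, a generalized eigenspace of `L_0`. -/
abbrev weightSpace (a lam : ℂ) (k : ℕ) (μ : ℂ) : Submodule ℂ (FockModule lam k) :=
  (L0 a lam k).maxGenEigenspace μ

/-- `o(v)|_{W_μ}`. -/
def zeroModeAt (a lam : ℂ) (k : ℕ) (μ : ℂ) (v : Fock) : Module.End ℂ (weightSpace a lam k μ) :=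
  (zeroMode lam k v).restrict
    (Module.End.mapsTo_maxGenEigenspace_of_comm (commute_zeroMode a lam k v) μ)

/-- `L_0|_{W_μ}`. -/
def L0At (a lam : ℂ) (k : ℕ) (μ : ℂ) : Module.End ℂ (weightSpace a lam k μ) :=
  (L0 a lam k).restrict
    (Module.End.mapsTo_maxGenEigenspace_of_comm (Commute.refl (L0 a lam k)) μ)

/-- The nilpotent part `(L_0^N)_μ` of `L_0|_{W_μ}`, whose semisimple part is `μ`. -/
def nilpotentPart (a lam : ℂ) (k : ℕ) (μ : ℂ) : Module.End ℂ (weightSpace a lam k μ) :=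
  L0At a lam k μ - μ • 1

/-- The vectors `u_j = (x - λ)^{k-j}`, `j = 1, …, k`, of `Ω(λ, k)`: a Jordan basis for `α_0`. -/
def jordanVector (lam : ℂ) (k j : ℕ) : Omega lam k :=
  (AdjoinRoot.root _ - algebraMap ℂ (Omega lam k) lam) ^ (k - j)

/-- `N` is an `M(1)`-submodule of `W`: it is stable under all modes `v_m`. -/
def IsVertexSubmodule (lam : ℂ) (k : ℕ) (N : Submodule ℂ (FockModule lam k)) : Prop :=
  ∀ (v : Fock) (m : ℤ), ∀ w ∈ N, ncoeff (Y lam k v) m w ∈ N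

/-- The `j`-th term `W^{(j)}` of the submodule chain `0 = W^{(0)} ⊂ ⋯ ⊂ W^{(k)} = W`: the
`M(1)`-submodule generated by `u_1, …, u_j`. -/
def chain (lam : ℂ) (k j : ℕ) : Submodule ℂ (FockModule lam k) :=
  sInf {N | IsVertexSubmodule lam k N ∧
    ∀ i, 1 ≤ i → i ≤ j → toFock lam k (1 ⊗ₜ jordanVector lam k i) ∈ N}

/-- A matrix of `k × k` blocks, each of size `d × d`, has the form
`[A C₁ ⋯ C_{k-2} B; 0 A ⋆ ⋯ C_{k-2}; ⋯; 0 ⋯ A C₁; 0 ⋯ 0 A]`. -/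
structure IsInterlockedForm {k d : ℕ} [NeZero k]
    (M : Matrix (Fin k × Fin d) (Fin k × Fin d) ℂ) : Prop where
  upper : ∀ i j : Fin k, j < i → ∀ s t, M (i, s) (j, t) = 0
  diag : ∀ (i : Fin k) s t, M (i, s) (i, t) = M (0, s) (0, t)
  outer : ∀ (j : Fin k) s t, M (0, s) (j, t) = M (j.rev, s) (Fin.rev 0, t)

/-- A strongly interlocked basis `B_{1,1}, …, B_{1,d}, …, B_{k,1}, …, B_{k,d}` of `W_μ` (the block
index is counted from `0` here). The block normalization is the one coming from the Jordan form
of `α_0`, which identifies `W^{(i+1)}/W^{(i)}` with `W^{(i)}/W^{(i-1)}` through `α_0 - λ`. -/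
structure StronglyInterlockedBasis (a lam : ℂ) (k : ℕ) [NeZero k] (μ : ℂ) where
  /-- the dimension of `Soc(W)_μ` -/
  d : ℕ
  /-- the basis of `W_μ` -/
  basis : Module.Basis (Fin k × Fin d) ℂ (weightSpace a lam k μ)
  /-- the first `j` blocks span `W^{(j)}_μ` -/
  span_eq : ∀ j ≤ k, Submodule.span ℂ (basis '' {p | (p.1 : ℕ) < j}) =
    (chain lam k j).comap (weightSpace a lam k μ).subtype
  /-- all operators generated by zero modes have interlocked block form -/
  form : ∀ σ ∈ Algebra.adjoin ℂ (Set.range (zeroModeAt a lam k μ)),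
    IsInterlockedForm (LinearMap.toMatrix basis basis σ)
  /-- `α_0|_{W_μ} = λ I + D_{kd,d}`, ones on the `d`-th superdiagonal -/
  alpha_zero : LinearMap.toMatrix basis basis (zeroModeAt a lam k μ (MvPolynomial.X 1)) =
    Matrix.of fun p r => (if p = r then lam else 0) +
      if (p.1 : ℕ) + 1 = r.1 ∧ p.2 = r.2 then 1 else 0

/-- The pseudo-trace of an operator on `W_μ`: the trace of the upper right block `B`. -/
def pstr {a lam : ℂ} {k : ℕ} [NeZero k] {μ : ℂ} (b : StronglyInterlockedBasis a lam k μ)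
    (σ : Module.End ℂ (weightSpace a lam k μ)) : ℂ :=
  Matrix.trace (Matrix.of fun s t => LinearMap.toMatrix b.basis b.basis σ (0, s) (Fin.rev 0, t))

/-- `q^s = e^{2 π i τ s}`. -/
def qPow (τ : UpperHalfPlane) (s : ℂ) : ℂ := Complex.exp (2 * Real.pi * Complex.I * τ * s)

/-- `log q = 2 π i τ`. -/
def logq (τ : UpperHalfPlane) : ℂ := 2 * Real.pi * Complex.I * τ

/-- The term `pstr(o(v)|_{W_μ} (1/j!) (L_0^N)_μ^j (log q)^j) q^{μ - c/24}` for `(μ, j)`. -/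
def gradedPseudoTraceTerm {a lam : ℂ} {k : ℕ} [NeZero k]
    (b : ∀ μ : ℂ, StronglyInterlockedBasis a lam k μ) (v : Fock) (τ : UpperHalfPlane)
    (p : ℂ × ℕ) : ℂ :=
  pstr (b p.1) (((1 / (p.2.factorial : ℂ)) * logq τ ^ p.2) •
    (zeroModeAt a lam k p.1 v * nilpotentPart a lam k p.1 ^ p.2)) *
    qPow τ (p.1 - centralCharge a / 24)

/-- The graded pseudo-trace `pstr_W(v, τ)`. -/
def gradedPseudoTrace {a lam : ℂ} {k : ℕ} [NeZero k]
    (b : ∀ μ : ℂ, StronglyInterlockedBasis a lam k μ) (v : Fock) (τ : UpperHalfPlane) : ℂ :=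
  ∑' p : ℂ × ℕ, gradedPseudoTraceTerm b v τ p

end FreeBoson

end

/-! Put N = α_0 - λ. Since α_0 is central in the Heisenberg algebra, N commutes with every mode, and
N^k = 0. On a monomial of weight ℓ tensored with Ω(λ, k), L_0 acts as λ²/2 - aλ + ℓ + (λ - a)N +
N²/2 (`L0_monomial`). Hence W_μ is nonzero only for μ = λ²/2 - aλ + ℓ with ℓ a natural number. It is
then the span of the monomials of weight ℓ tensored with Ω(λ, k), and L_0 has nilpotent part N((λ -
a) + N/2) there (`mem_weightSpace_iff`, `nilpotentPart_eq`).

Existence: in the basis of monomials times u_j, N is the block superdiagonal shift. A matrix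
commuting with that shift is block upper triangular and block Toeplitz, which gives the interlocked
form (`isInterlockedForm_of_commute`). The chain terms are the images of powers of N
(`chain_eq_span`).

Value: the normalization by α_0 makes N the same shift matrix in every strongly interlocked basis,
so the pseudo-trace of N^m is d if m = k - 1 and 0 otherwise. The binomial theorem then gives the
pseudo-trace of the j-th power of the nilpotent part (`pstr_nilpotentPart_pow`). The block size d is
the number of partitions of ℓ, and Euler's product turns the sum over ℓ into 1/η. -/

noncomputable section

namespace FreeBoson

open Filter Topology

/-! ### Euler's product for the partition numbers. -/

/-- The generating function of the partitions with parts at most `N`. -/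
def boundedPartitionSeries (N : ℕ) : PowerSeries ℕ :=
  ∏ i ∈ Finset.range N, PowerSeries.mk fun n => if i + 1 ∣ n then 1 else 0

theorem boundedPartitionSeries_succ (N : ℕ) : boundedPartitionSeries (N + 1) =
    boundedPartitionSeries N * PowerSeries.mk fun n => if N + 1 ∣ n then 1 else 0 :=
  Finset.prod_range_succ _ _

open scoped PowerSeries.WithPiTopology in
theorem tsum_X_pow_mul (i : ℕ) : ∑' j : ℕ, (PowerSeries.X ^ ((i + 1) * j) : PowerSeries ℕ) =
    PowerSeries.mk fun n => if i + 1 ∣ n then 1 else 0 := by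
  have hs : Summable fun j : ℕ => (PowerSeries.X ^ ((i + 1) * j) : PowerSeries ℕ) := by
    simp only [pow_mul]
    exact PowerSeries.WithPiTopology.summable_pow_of_constantCoeff_eq_zero (by simp)
  ext n
  have h := hs.hasSum.map (PowerSeries.coeff (R := ℕ) n)
    (PowerSeries.WithPiTopology.continuous_coeff ℕ n)
  rw [PowerSeries.coeff_mk, ← h.tsum_eq]
  simp only [Function.comp_def, PowerSeries.coeff_X_pow]
  split_ifs with hd
  · obtain ⟨c, rfl⟩ := hd
    rw [tsum_eq_single c, if_pos rfl]
    intro j hj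
    rw [if_neg]
    intro h'
    exact hj (Nat.eq_of_mul_eq_mul_left (Nat.succ_pos i) h').symm
  · convert tsum_zero with j
    rw [if_neg]
    rintro rfl
    exact hd ⟨j, rfl⟩

-- The infinite product converges coefficientwise, and ℕ is discrete, so each coefficient is
-- eventually constant.
open scoped PowerSeries.WithPiTopology in
theorem eventually_coeff_boundedPartitionSeries (n : ℕ) : ∀ᶠ N in atTop,
    PowerSeries.coeff n (boundedPartitionSeries N) = Fintype.card (Nat.Partition n) := by
  have h := (Nat.Partition.hasProd_powerSeriesMk_card_restricted ℕ
    (fun _ => True)).tendsto_prod_nat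
  have h' := ((PowerSeries.WithPiTopology.continuous_coeff ℕ n).tendsto _).comp h
  rw [nhds_discrete, tendsto_pure] at h'
  filter_upwards [h'] with N hN
  simpa [tsum_X_pow_mul, boundedPartitionSeries, Nat.Partition.restricted] using hN

/-- The factor added at each step has constant term 1 and nonnegative coefficients. -/
theorem coeff_boundedPartitionSeries_mono (n : ℕ) :
    Monotone fun N => PowerSeries.coeff n (boundedPartitionSeries N) := by
  refine monotone_nat_of_le_succ fun N => ?_
  rw [boundedPartitionSeries_succ, PowerSeries.coeff_mul]
  refine le_trans (le_of_eq ?_) (Finset.single_le_sum (fun _ _ => Nat.zero_le _)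
    (Finset.HasAntidiagonal.mem_antidiagonal.2 (add_zero n) : (n, 0) ∈ Finset.HasAntidiagonal.antidiagonal n))
  simp

theorem coeff_boundedPartitionSeries_le (N n : ℕ) :
    PowerSeries.coeff n (boundedPartitionSeries N) ≤ Fintype.card (Nat.Partition n) := by
  obtain ⟨M, hM, h⟩ :=
    ((eventually_ge_atTop N).and (eventually_coeff_boundedPartitionSeries n)).exists
  exact h ▸ coeff_boundedPartitionSeries_mono n hM

theorem hasSum_dvd_mul_pow (i : ℕ) {q : ℂ} (hq : ‖q‖ < 1) :
    HasSum (fun n : ℕ => (((if i + 1 ∣ n then 1 else 0 : ℕ) : ℂ)) * q ^ n)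
      (1 - q ^ (i + 1))⁻¹ := by
  have h := hasSum_geometric_of_norm_lt_one (ξ := q ^ (i + 1))
    (by rw [norm_pow]; exact pow_lt_one₀ (norm_nonneg _) hq (Nat.succ_ne_zero i))
  have hinj : Function.Injective fun j : ℕ => (i + 1) * j :=
    fun _ _ h' => Nat.eq_of_mul_eq_mul_left (Nat.succ_pos i) h'
  rw [← hinj.hasSum_iff]
  · simpa [Function.comp_def, pow_mul] using h
  · intro n hn
    rw [if_neg, Nat.cast_zero, zero_mul]
    rintro ⟨c, rfl⟩
    exact hn ⟨c, rfl⟩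

/-- By induction: each new factor is a geometric series in `q ^ (N + 1)`, multiplied in by the
Cauchy product of absolutely convergent series. -/
theorem hasSum_boundedPartitionSeries (N : ℕ) {q : ℂ} (hq : ‖q‖ < 1) :
    HasSum (fun n : ℕ => ((PowerSeries.coeff n (boundedPartitionSeries N) : ℕ) : ℂ) * q ^ n)
      (∏ i ∈ Finset.range N, (1 - q ^ (i + 1)))⁻¹ := by
  induction N with
  | zero =>
    convert hasSum_ite_eq (0 : ℕ) (1 : ℂ) using 1
    · ext n
      by_cases h : n = 0 <;> simp [boundedPartitionSeries, PowerSeries.coeff_one, h]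
    · simp
  | succ N ih =>
    have hg := hasSum_dvd_mul_pow N hq
    have h1 := summable_norm_sum_mul_antidiagonal_of_summable_norm ih.summable.norm
      hg.summable.norm
    have h2 := tsum_mul_tsum_eq_tsum_sum_antidiagonal_of_summable_norm ih.summable.norm
      hg.summable.norm
    rw [ih.tsum_eq, hg.tsum_eq] at h2
    rw [Finset.prod_range_succ, mul_inv, h2]
    have h3 := h1.of_norm.hasSum
    refine Eq.mp (congrArg (HasSum · _) (funext fun n => ?_)) h3
    rw [boundedPartitionSeries_succ, PowerSeries.coeff_mul, Nat.cast_sum, Finset.sum_mul]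
    refine Finset.sum_congr rfl fun p hp => ?_
    rw [← Finset.HasAntidiagonal.mem_antidiagonal.1 hp, pow_add, PowerSeries.coeff_mk]
    push_cast
    ring

theorem one_sub_pow_ne_zero {q : ℂ} (hq : ‖q‖ < 1) (i : ℕ) : 1 - q ^ (i + 1) ≠ 0 := by
  intro h
  have h1 : ‖q‖ ^ (i + 1) < 1 := pow_lt_one₀ (norm_nonneg _) hq (Nat.succ_ne_zero i)
  rw [← norm_pow, ← sub_eq_zero.1 h, norm_one] at h1
  exact lt_irrefl _ h1

theorem tprod_one_sub_pow_ne_zero {q : ℂ} (hq : ‖q‖ < 1) : ∏' i : ℕ, (1 - q ^ (i + 1)) ≠ 0 := by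
  simp only [sub_eq_add_neg]
  refine tprod_one_add_ne_zero_of_summable (fun i => ?_) ?_
  · simpa [← sub_eq_add_neg] using one_sub_pow_ne_zero hq i
  · simpa using (summable_nat_add_iff 1).mpr (summable_geometric_of_lt_one (norm_nonneg _) hq)

theorem tendsto_inv_prod_one_sub_pow {q : ℂ} (hq : ‖q‖ < 1) :
    Tendsto (fun N : ℕ => (∏ i ∈ Finset.range N, (1 - q ^ (i + 1)))⁻¹) atTop
      (𝓝 (∏' i : ℕ, (1 - q ^ (i + 1)))⁻¹) :=
  (ModularForm.multipliable_one_sub_pow hq).hasProd.tendsto_prod_nat.inv₀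
    (tprod_one_sub_pow_ne_zero hq)

/-- At the real point ‖q‖, any finite partial sum is a partial sum of the bounded series once N is
large. It is therefore at most the inverse of a finite product, and these inverses converge. -/
theorem summable_norm_card_partition_mul_pow {q : ℂ} (hq : ‖q‖ < 1) :
    Summable fun n : ℕ => ‖(Fintype.card (Nat.Partition n) : ℂ) * q ^ n‖ := by
  have hr : ‖(‖q‖ : ℂ)‖ < 1 := by simpa using hq
  refine summable_of_sum_le (c := ‖(∏' i : ℕ, (1 - (‖q‖ : ℂ) ^ (i + 1)))⁻¹‖)
    (fun _ => norm_nonneg _) fun u => ?_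
  refine le_of_tendsto_of_tendsto tendsto_const_nhds (tendsto_inv_prod_one_sub_pow hr).norm ?_
  filter_upwards [(Finset.eventually_all u).2 fun n _ =>
    eventually_coeff_boundedPartitionSeries n] with N hN
  have h := hasSum_boundedPartitionSeries N hr
  have h' : HasSum (fun n : ℕ => ((PowerSeries.coeff n (boundedPartitionSeries N) : ℕ) : ℝ) * ‖q‖ ^ n)
      (∑' n : ℕ, ((PowerSeries.coeff n (boundedPartitionSeries N) : ℕ) : ℝ) * ‖q‖ ^ n) := by
    refine Summable.hasSum ?_
    have := h.summable.norm
    simpa using this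
  -- The complex sum is the cast of a sum of nonnegative reals, so its norm dominates every finite
  -- partial sum.
  have h2 := h.unique (by simpa only [Complex.ofReal_mul, Complex.ofReal_natCast,
    Complex.ofReal_pow] using Complex.hasSum_ofReal.2 h')
  rw [h2, Complex.norm_real]
  refine le_trans ?_ (le_abs_self _)
  refine le_trans (le_of_eq (Finset.sum_congr rfl fun n hn => ?_))
    (h'.summable.sum_le_tsum u fun n _ => by positivity)
  rw [hN n hn]
  simp

/-- Euler's product formula for the generating function of the partition numbers. -/
theorem hasSum_card_partition_mul_pow {q : ℂ} (hq : ‖q‖ < 1) :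
    HasSum (fun n : ℕ => (Fintype.card (Nat.Partition n) : ℂ) * q ^ n)
      (∏' i : ℕ, (1 - q ^ (i + 1)))⁻¹ := by
  have hs := summable_norm_card_partition_mul_pow hq
  have h : Tendsto (fun N => ∑' n : ℕ,
      ((PowerSeries.coeff n (boundedPartitionSeries N) : ℕ) : ℂ) * q ^ n) atTop
      (𝓝 (∑' n : ℕ, (Fintype.card (Nat.Partition n) : ℂ) * q ^ n)) := by
    -- Dominated convergence: coefficients increase to the partition numbers, which supply the
    -- summable bound.
    refine tendsto_tsum_of_dominated_convergence hs (fun n => ?_) (Eventually.of_forall fun N n => ?_)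
    · refine tendsto_const_nhds.congr' ?_
      filter_upwards [eventually_coeff_boundedPartitionSeries n] with N hN
      rw [hN]
    · rw [norm_mul, norm_mul, Complex.norm_natCast, Complex.norm_natCast]
      gcongr
      exact coeff_boundedPartitionSeries_le N n
  have h2 := tendsto_inv_prod_one_sub_pow hq
  simp only [(hasSum_boundedPartitionSeries _ hq).tsum_eq] at h
  rw [← tendsto_nhds_unique h h2]
  exact hs.of_norm.hasSum

/-! ### Powers of q and the eta function. -/

theorem norm_qPow_one_lt_one (τ : UpperHalfPlane) : ‖qPow τ 1‖ < 1 := by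
  simpa [qPow] using UpperHalfPlane.norm_exp_two_pi_I_lt_one τ

theorem qPow_add (τ : UpperHalfPlane) (s t : ℂ) : qPow τ (s + t) = qPow τ s * qPow τ t := by
  rw [qPow, qPow, qPow, ← Complex.exp_add, mul_add]

theorem qPow_natCast (τ : UpperHalfPlane) (n : ℕ) : qPow τ n = qPow τ 1 ^ n := by
  rw [qPow, qPow, ← Complex.exp_nat_mul]
  congr 1
  ring

theorem summable_norm_qPow_mul_card_partition (τ : UpperHalfPlane) :
    Summable fun l : ℕ => ‖qPow τ l * (Fintype.card (Nat.Partition l) : ℂ)‖ := by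
  simpa only [qPow_natCast, mul_comm] using
    summable_norm_card_partition_mul_pow (norm_qPow_one_lt_one τ)

theorem qPow_mul_tsum_card_partition (τ : UpperHalfPlane) :
    qPow τ (-1 / 24) * ∑' l : ℕ, qPow τ l * (Fintype.card (Nat.Partition l) : ℂ) =
      (ModularForm.eta τ)⁻¹ := by
  have h := (hasSum_card_partition_mul_pow (norm_qPow_one_lt_one τ)).tsum_eq
  simp only [qPow_natCast, mul_comm _ (Fintype.card _ : ℂ), h]
  rw [ModularForm.eta, mul_inv]
  congr 1
  · rw [qPow, Function.Periodic.qParam, ← Complex.exp_neg]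
    congr 1
    push_cast
    ring
  · congr 1
    refine tprod_congr fun n => ?_
    rw [ModularForm.eta_q_eq_pow, qPow, mul_one]

end FreeBoson

end

/-! ### The Jordan basis of Ω(λ, k), the action of L_0 and its generalized eigenspaces. -/

noncomputable section

namespace FreeBoson

open VertexOperator TensorProduct

/-- The nilpotent element `x - λ` of `Ω(λ, k)`. -/
def omegaNil (lam : ℂ) (k : ℕ) : Omega lam k :=
  AdjoinRoot.root _ - algebraMap ℂ (Omega lam k) lam

theorem jordanVector_eq (lam : ℂ) (k j : ℕ) : jordanVector lam k j = omegaNil lam k ^ (k - j) := rfl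

theorem omegaNil_pow (lam : ℂ) (k : ℕ) : omegaNil lam k ^ k = 0 := by
  have h := AdjoinRoot.mk_self (f := ((Polynomial.X - Polynomial.C lam) ^ k : Polynomial ℂ))
  rw [map_pow, map_sub, AdjoinRoot.mk_X, AdjoinRoot.mk_C] at h
  exact h

theorem finrank_omega (lam : ℂ) (k : ℕ) : Module.finrank ℂ (Omega lam k) = k := by
  have hm : ((Polynomial.X - Polynomial.C lam) ^ k : Polynomial ℂ).Monic :=
    (Polynomial.monic_X_sub_C lam).pow k
  rw [(AdjoinRoot.powerBasis' hm).finrank, AdjoinRoot.powerBasis'_dim,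
    (Polynomial.monic_X_sub_C lam).natDegree_pow, Polynomial.natDegree_X_sub_C, mul_one]

/-- The minimal polynomial of x - λ is a translate of that of x, namely of (X - λ)^k; this makes the
powers of x - λ below k independent. -/
theorem natDegree_minpoly_omegaNil (lam : ℂ) (k : ℕ) :
    (minpoly ℂ (omegaNil lam k)).natDegree = k := by
  have hm : ((Polynomial.X - Polynomial.C lam) ^ k : Polynomial ℂ).Monic :=
    (Polynomial.monic_X_sub_C lam).pow k
  rw [omegaNil, minpoly.sub_algebraMap, Polynomial.natDegree_comp,
    AdjoinRoot.minpoly_root hm.ne_zero, hm.leadingCoeff, inv_one, Polynomial.C_1, mul_one,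
    Polynomial.natDegree_X_add_C, (Polynomial.monic_X_sub_C lam).natDegree_pow,
    Polynomial.natDegree_X_sub_C, mul_one, mul_one]

theorem linearIndependent_jordanVector (lam : ℂ) (k : ℕ) :
    LinearIndependent ℂ fun i : Fin k => jordanVector lam k (i + 1) := by
  have h := linearIndependent_pow (K := ℂ) (omegaNil lam k)
  have h2 := h.comp (fun i : Fin k => Fin.cast (natDegree_minpoly_omegaNil lam k).symm i.rev)
    ((Fin.cast_injective _).comp Fin.rev_injective)
  have he : (fun i : Fin k => jordanVector lam k (i + 1)) =
      (fun i : Fin _ => omegaNil lam k ^ (i : ℕ)) ∘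
        fun i : Fin k => Fin.cast (natDegree_minpoly_omegaNil lam k).symm i.rev := by
    funext i
    simp [jordanVector_eq, Fin.val_rev]
  rw [he]
  exact h2

/-- The basis `u_1, …, u_k` of `Ω(λ, k)`. -/
def jordanBasis (lam : ℂ) (k : ℕ) [NeZero k] : Module.Basis (Fin k) ℂ (Omega lam k) :=
  basisOfLinearIndependentOfCardEqFinrank (linearIndependent_jordanVector lam k)
    (by rw [Fintype.card_fin, finrank_omega])

theorem jordanBasis_apply (lam : ℂ) (k : ℕ) [NeZero k] (i : Fin k) :
    jordanBasis lam k i = jordanVector lam k (i + 1) := by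
  simp [jordanBasis]

/-- The basis of `W` formed by the vectors `α_{-n₁} ⋯ α_{-nᵣ} u_j`. -/
def fockBasis (lam : ℂ) (k : ℕ) [NeZero k] :
    Module.Basis ((ℕ+ →₀ ℕ) × Fin k) ℂ (FockModule lam k) :=
  ((MvPolynomial.basisMonomials ℕ+ ℂ).tensorProduct (jordanBasis lam k)).map (toFock lam k)

theorem fockBasis_apply (lam : ℂ) (k : ℕ) [NeZero k] (s : ℕ+ →₀ ℕ) (i : Fin k) :
    fockBasis lam k (s, i) =
      toFock lam k (MvPolynomial.monomial s 1 ⊗ₜ jordanVector lam k (i + 1)) := by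
  rw [fockBasis, Module.Basis.map_apply, Module.Basis.tensorProduct_apply, jordanBasis_apply,
    MvPolynomial.coe_basisMonomials]

/-- The coefficient in `Ω(λ, k)` of a monomial. -/
def component (lam : ℂ) (k : ℕ) (s : ℕ+ →₀ ℕ) : FockModule lam k →ₗ[ℂ] Omega lam k :=
  Finsupp.lapply s ∘ₗ
    (TensorProduct.equivFinsuppOfBasisLeft (MvPolynomial.basisMonomials ℕ+ ℂ)).toLinearMap ∘ₗ
    (toFock lam k).symm.toLinearMap

theorem component_tmul (lam : ℂ) (k : ℕ) (s : ℕ+ →₀ ℕ) (p : Fock) (u : Omega lam k) :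
    component lam k s (toFock lam k (p ⊗ₜ u)) = MvPolynomial.coeff s p • u := by
  simp only [component, LinearMap.comp_apply, LinearEquiv.coe_coe, LinearEquiv.symm_apply_apply,
    Finsupp.lapply_apply, TensorProduct.equivFinsuppOfBasisLeft_apply_tmul_apply]
  rfl

theorem eq_zero_of_component {lam : ℂ} {k : ℕ} {w : FockModule lam k}
    (h : ∀ s, component lam k s w = 0) : w = 0 := by
  rw [← (toFock lam k).symm.map_eq_zero_iff, ← (TensorProduct.equivFinsuppOfBasisLeft
    (MvPolynomial.basisMonomials ℕ+ ℂ)).map_eq_zero_iff]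
  exact Finsupp.ext h

theorem component_alpha_zero (lam : ℂ) (k : ℕ) (s : ℕ+ →₀ ℕ) (w : FockModule lam k) :
    component lam k s (alpha lam k 0 w) = AdjoinRoot.root _ * component lam k s w := by
  refine FockModule.induction (P := fun w => component lam k s (alpha lam k 0 w) =
    AdjoinRoot.root _ * component lam k s w) w (by simp) (fun p u => ?_) fun v w hv hw => ?_
  · refine (congrArg _ (alpha_zero_tmul lam k p u)).trans ?_
    rw [component_tmul, component_tmul, mul_smul_comm]
  · simp only [map_add, hv, hw, mul_add]

/-- The nilpotent operator `α_0 - λ` on `W`. -/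
def shift (lam : ℂ) (k : ℕ) : Module.End ℂ (FockModule lam k) := alpha lam k 0 - lam • 1

theorem shift_tmul (lam : ℂ) (k : ℕ) (p : Fock) (u : Omega lam k) :
    shift lam k (toFock lam k (p ⊗ₜ u)) = toFock lam k (p ⊗ₜ (omegaNil lam k * u)) := by
  rw [shift, LinearMap.sub_apply, omegaNil, sub_mul, tmul_sub, map_sub]
  refine congrArg₂ _ (alpha_zero_tmul lam k p u) ?_
  rw [← Algebra.smul_def, tmul_smul, map_smul]
  rfl

theorem shift_pow_tmul (lam : ℂ) (k n : ℕ) (p : Fock) (u : Omega lam k) :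
    (shift lam k ^ n) (toFock lam k (p ⊗ₜ u)) = toFock lam k (p ⊗ₜ (omegaNil lam k ^ n * u)) := by
  induction n with
  | zero => simp
  | succ n ih => rw [pow_succ', Module.End.mul_apply, ih, shift_tmul, pow_succ', mul_assoc]

theorem component_shift (lam : ℂ) (k : ℕ) (s : ℕ+ →₀ ℕ) (w : FockModule lam k) :
    component lam k s (shift lam k w) = omegaNil lam k * component lam k s w := by
  rw [shift, LinearMap.sub_apply, map_sub, component_alpha_zero, omegaNil, sub_mul,
    ← Algebra.smul_def]
  simp

theorem monomialWeight_eq_sum (s : ℕ+ →₀ ℕ) :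
    monomialWeight s = ∑ n ∈ s.support, (s n : ℤ) * (n : ℕ) := by
  rw [monomialWeight, Finsupp.toMultiset_apply, Finsupp.sum, ← Multiset.coe_mapAddMonoidHom,
    map_sum, ← Multiset.coe_sumAddMonoidHom, map_sum]
  refine Finset.sum_congr rfl fun n _ => ?_
  simp [Multiset.nsmul_singleton]

/-- For n = i + 1 > 0, α_{-n} α_n is n times the Euler operator X_n ∂/∂X_n, which counts the
multiplicity of X_n in a monomial. -/
theorem alpha_negSucc_alpha_succ (lam : ℂ) (k : ℕ) (s : ℕ+ →₀ ℕ) (u : Omega lam k) (i : ℕ) :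
    alpha lam k (-1 - i) (alpha lam k (1 + i) (toFock lam k (MvPolynomial.monomial s 1 ⊗ₜ u))) =
      (((i + 1 : ℕ) : ℂ) * (s i.succPNat : ℂ)) •
        toFock lam k (MvPolynomial.monomial s 1 ⊗ₜ u) := by
  rw [show (-1 - i : ℤ) = Int.negSucc i by rw [Int.negSucc_eq]; ring,
    show (1 + i : ℤ) = Int.ofNat (i + 1) by rw [Int.ofNat_eq_natCast]; push_cast; ring,
    alpha_pos_tmul, map_smul, alpha_neg_tmul, MvPolynomial.X_mul_pderiv_monomial,
    ← Nat.cast_smul_eq_nsmul ℂ, ← smul_tmul', map_smul, smul_smul]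

theorem sum_range_monomialWeight (s : ℕ+ →₀ ℕ) {M : ℕ} (hM : ∀ n ∈ s.support, (n : ℕ) ≤ M) :
    ∑ i ∈ Finset.range M, (((i + 1 : ℕ) : ℂ) * (s i.succPNat : ℂ)) = (monomialWeight s : ℂ) := by
  rw [monomialWeight_eq_sum]
  push_cast
  symm
  refine Finset.sum_bij_ne_zero (fun n _ _ => n.natPred) ?_ ?_ ?_ ?_
  · intro n hn _
    have h1 := hM n hn
    have h2 := n.natPred_add_one
    exact Finset.mem_range.2 (by lia)
  · intro n _ _ m _ _ h
    exact PNat.natPred_injective h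
  · intro i hi h
    have : s i.succPNat ≠ 0 := by
      intro h0
      simp [h0] at h
    refine ⟨i.succPNat, Finsupp.mem_support_iff.2 this, ?_, by simp⟩
    simp [this]
    exact_mod_cast Nat.succ_ne_zero i
  · intro n _ _
    rw [PNat.succPNat_natPred]
    have := n.natPred_add_one
    rw [mul_comm]
    congr 1
    exact_mod_cast this.symm

/-- In the sum for L_0 each α_{-n} α_n with n > 0 occurs twice, which cancels the factor 1/2 and
leaves the weight. What remains is α_0²/2 - a α_0, expanded at x = λ + (x - λ). -/
theorem L0_monomial (a lam : ℂ) (k : ℕ) (s : ℕ+ →₀ ℕ) (u : Omega lam k) :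
    L0 a lam k (toFock lam k (MvPolynomial.monomial s 1 ⊗ₜ u)) =
      toFock lam k (MvPolynomial.monomial s 1 ⊗ₜ
        ((algebraMap ℂ _ (monomialWeight s + (lam ^ 2 / 2 - a * lam)) +
          ((lam - a) • omegaNil lam k + (1 / 2 : ℂ) • omegaNil lam k ^ 2)) * u)) := by
  obtain ⟨M, hM⟩ : ∃ M : ℕ, ∀ n ∈ s.support, (n : ℕ) ≤ M :=
    ⟨s.support.sup fun n : ℕ+ => (n : ℕ), fun n hn => Finset.le_sup (f := fun n : ℕ+ => (n : ℕ)) hn⟩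
  have hz : ∀ i, M ≤ i → s i.succPNat = 0 := fun i hi => by
    by_contra h
    have := hM _ (Finsupp.mem_support_iff.2 h)
    rw [Nat.succPNat_coe] at this
    lia
  have h0 : ∀ v : Omega lam k, alpha lam k 0 (toFock lam k (MvPolynomial.monomial s 1 ⊗ₜ v)) =
      toFock lam k (MvPolynomial.monomial s 1 ⊗ₜ (AdjoinRoot.root _ * v)) :=
    fun v => alpha_zero_tmul lam k _ v
  have h1 : ∀ i : ℕ, alpha lam k (-((i + 1 : ℕ) : ℤ)) (alpha lam k ((i + 1 : ℕ) : ℤ)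
      (toFock lam k (MvPolynomial.monomial s 1 ⊗ₜ u))) =
      (((i + 1 : ℕ) : ℂ) * (s i.succPNat : ℂ)) •
        toFock lam k (MvPolynomial.monomial s 1 ⊗ₜ u) := fun i => by
    rw [← alpha_negSucc_alpha_succ]
    congr 2
    · push_cast; ring
    · push_cast; ring_nf
  have hsub : (Function.support fun i : ℕ =>
      alpha lam k (-1 - i) (alpha lam k (1 + i) (toFock lam k (MvPolynomial.monomial s 1 ⊗ₜ u))) +
      alpha lam k (-i) (alpha lam k i (toFock lam k (MvPolynomial.monomial s 1 ⊗ₜ u)))) ⊆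
      ↑(Finset.range (M + 1)) := by
    intro i hi
    by_contra h
    have h' : M + 1 ≤ i := by simpa using h
    obtain ⟨n, rfl⟩ : ∃ n, i = n + 1 := ⟨i - 1, by lia⟩
    refine hi ?_
    change _ + _ = _
    rw [alpha_negSucc_alpha_succ, h1, hz _ (by lia), hz _ (by lia)]
    simp
  -- `sum_range_succ'` splits off the i = 0 term, which is α_0².
  rw [L0_apply, finsum_eq_sum_of_support_subset _ hsub, Finset.sum_add_distrib,
    Finset.sum_range_succ' (fun i : ℕ => alpha lam k (-i) _)]
  simp only [alpha_negSucc_alpha_succ, h1]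
  rw [← Finset.sum_smul, ← Finset.sum_smul, sum_range_monomialWeight s hM,
    sum_range_monomialWeight s (fun n hn => (hM n hn).trans (Nat.le_succ M))]
  simp only [Nat.cast_zero, neg_zero, h0]
  have hr : AdjoinRoot.root ((Polynomial.X - Polynomial.C lam) ^ k : Polynomial ℂ) =
      omegaNil lam k + algebraMap ℂ _ lam := by simp [omegaNil]
  rw [hr]
  simp only [← map_smul, ← map_add, ← map_sub, ← tmul_smul, ← tmul_add, ← tmul_sub]
  congr 2
  simp only [Algebra.algebraMap_eq_smul_one, add_mul, mul_add, smul_mul_assoc, one_mul, mul_smul_comm, pow_two, mul_assoc]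
  module

theorem component_L0 (a lam : ℂ) (k : ℕ) [NeZero k] (s : ℕ+ →₀ ℕ) (w : FockModule lam k) :
    component lam k s (L0 a lam k w) =
      (algebraMap ℂ _ (monomialWeight s + (lam ^ 2 / 2 - a * lam)) +
          ((lam - a) • omegaNil lam k + (1 / 2 : ℂ) • omegaNil lam k ^ 2)) *
        component lam k s w := by
  have h : component lam k s ∘ₗ L0 a lam k = LinearMap.mulLeft ℂ
      (algebraMap ℂ _ (monomialWeight s + (lam ^ 2 / 2 - a * lam)) +
          ((lam - a) • omegaNil lam k + (1 / 2 : ℂ) • omegaNil lam k ^ 2)) ∘ₗ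
        component lam k s := by
    refine (fockBasis lam k).ext fun ⟨t, i⟩ => ?_
    rw [fockBasis_apply, LinearMap.comp_apply, LinearMap.comp_apply, L0_monomial, component_tmul,
      component_tmul, MvPolynomial.coeff_monomial, LinearMap.mulLeft_apply]
    split_ifs with hst
    · rw [hst, one_smul, one_smul]
    · rw [zero_smul, zero_smul, mul_zero]
  exact LinearMap.congr_fun h w

theorem component_L0_sub_pow (a lam : ℂ) (k : ℕ) [NeZero k] (μ : ℂ) (m : ℕ) (s : ℕ+ →₀ ℕ)
    (w : FockModule lam k) : component lam k s (((L0 a lam k - μ • 1) ^ m) w) =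
      (algebraMap ℂ _ (monomialWeight s + (lam ^ 2 / 2 - a * lam) - μ) +
          ((lam - a) • omegaNil lam k + (1 / 2 : ℂ) • omegaNil lam k ^ 2)) ^ m *
        component lam k s w := by
  induction m with
  | zero => simp
  | succ m ih =>
    rw [pow_succ', Module.End.mul_apply, LinearMap.sub_apply, map_sub, component_L0,
      LinearMap.smul_apply, Module.End.one_apply, map_smul, ih, map_sub, Algebra.smul_def μ]
    ring

theorem smul_omegaNil_add_pow_eq_zero (a lam : ℂ) (k : ℕ) :
    ((lam - a) • omegaNil lam k + (1 / 2 : ℂ) • omegaNil lam k ^ 2) ^ k = 0 := by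
  rw [show (lam - a) • omegaNil lam k + (1 / 2 : ℂ) • omegaNil lam k ^ 2 =
      omegaNil lam k * ((lam - a) • 1 + (1 / 2 : ℂ) • omegaNil lam k) by
    rw [mul_add, mul_smul_comm, mul_smul_comm, mul_one, pow_two], mul_pow, omegaNil_pow, zero_mul]

/-- On the component of a monomial, L_0 - μ multiplies by a scalar plus a nilpotent. This is a unit
when the scalar is nonzero, so a power can kill the component only if it is already zero; when the
scalar vanishes the k-th power kills everything. -/
theorem mem_weightSpace_iff {a lam : ℂ} {k : ℕ} [NeZero k] {μ : ℂ} {w : FockModule lam k} :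
    w ∈ weightSpace a lam k μ ↔
      ∀ s, (monomialWeight s : ℂ) + (lam ^ 2 / 2 - a * lam) ≠ μ → component lam k s w = 0 := by
  rw [Module.End.mem_maxGenEigenspace]
  constructor
  · rintro ⟨m, hm⟩ s hs
    have h := component_L0_sub_pow a lam k μ m s w
    rw [hm, map_zero] at h
    have hu : IsUnit (algebraMap ℂ (Omega lam k)
        (monomialWeight s + (lam ^ 2 / 2 - a * lam) - μ) +
        ((lam - a) • omegaNil lam k + (1 / 2 : ℂ) • omegaNil lam k ^ 2)) := by
      refine IsNilpotent.isUnit_add_left_of_commute ⟨k, smul_omegaNil_add_pow_eq_zero a lam k⟩ ?_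
        (Commute.all _ _)
      exact (IsUnit.mk0 _ (sub_ne_zero.2 hs)).map _
    exact ((hu.pow m).mul_right_eq_zero.1 h.symm)
  · intro h
    refine ⟨k, eq_zero_of_component fun s => ?_⟩
    rw [component_L0_sub_pow]
    by_cases hs : (monomialWeight s : ℂ) + (lam ^ 2 / 2 - a * lam) = μ
    · rw [hs, sub_self, map_zero, zero_add, smul_omegaNil_add_pow_eq_zero, zero_mul]
    · rw [h s hs, mul_zero]

end FreeBoson

end

/-! ### Commutation with α_0 - λ, and the submodule chain. -/

noncomputable section

namespace FreeBoson

open VertexOperator TensorProduct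

/-- On each vector the defining sum is finite, so a linear operator passes through it term by term.
-/
theorem commute_ncoeff_nthProd {W : Type*} [AddCommGroup W] [Module ℂ W] {T : Module.End ℂ W}
    {A B : VertexOperator ℂ W} (hA : ∀ m, Commute T (ncoeff A m))
    (hB : ∀ m, Commute T (ncoeff B m)) (n m : ℤ) : Commute T (ncoeff (nthProd n A B) m) := by
  have hA' : ∀ m w, T (ncoeff A m w) = ncoeff A m (T w) := fun m w => LinearMap.congr_fun (hA m) w
  have hB' : ∀ m w, T (ncoeff B m w) = ncoeff B m (T w) := fun m w => LinearMap.congr_fun (hB m) w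
  refine LinearMap.ext fun w => ?_
  rw [ncoeff_nthProd, Module.End.mul_apply, Module.End.mul_apply]
  change T (∑ᶠ i : ℕ, nthProdTerm n A B m i w) = ∑ᶠ i : ℕ, nthProdTerm n A B m i (T w)
  rw [← LinearMap.toAddMonoidHom_coe,
    AddMonoidHom.map_finsum _ (nthProdTerm_support n A B m w)]
  refine finsum_congr fun i => ?_
  simp only [nthProdTerm, LinearMap.toAddMonoidHom_coe, LinearMap.smul_apply, LinearMap.sub_apply,
    Module.End.mul_apply, map_smul, map_sub, hA', hB']

/-- The central term m δ_{m+n,0} vanishes for m = 0. -/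
theorem commute_shift_alpha (lam : ℂ) (k : ℕ) (m : ℤ) :
    Commute (shift lam k) (alpha lam k m) := by
  refine Commute.sub_left (LinearMap.ext fun w => ?_)
    ((Commute.one_left (alpha lam k m)).smul_left lam)
  have h := alpha_comm lam k 0 m w
  rw [Int.cast_zero, ite_self, zero_smul, add_zero] at h
  exact h

theorem commute_shift_monomialField (lam : ℂ) (k : ℕ) (s : ℕ+ →₀ ℕ) (m : ℤ) :
    Commute (shift lam k) (ncoeff (monomialField lam k s) m) := by
  have key : ∀ l : List ℕ+, ∀ m, Commute (shift lam k) (ncoeff (listField lam k l) m) := by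
    intro l
    induction l with
    | nil =>
      intro m
      change Commute _ (ncoeff idField m)
      rw [ncoeff_idField]
      split_ifs
      · exact Commute.one_right _
      · exact Commute.zero_right _
    | cons n l ih =>
      exact commute_ncoeff_nthProd
        (fun m => by rw [ncoeff_alphaField]; exact commute_shift_alpha lam k m) ih _
  exact key _ m

/-- Thus α_0 - λ is a module endomorphism, and the images of its powers are submodules. -/
theorem commute_shift_ncoeff_Y (lam : ℂ) (k : ℕ) (v : Fock) (m : ℤ) :
    Commute (shift lam k) (ncoeff (Y lam k v) m) := by
  rw [Y, Module.Basis.constr_apply, Finsupp.sum, map_sum, Finset.sum_apply]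
  refine Commute.sum_right _ _ _ fun s _ => ?_
  rw [map_smul, Pi.smul_apply]
  exact (commute_shift_monomialField lam k s m).smul_right _

theorem commute_shift_zeroMode (lam : ℂ) (k : ℕ) (v : Fock) :
    Commute (shift lam k) (zeroMode lam k v) := by
  rw [zeroMode, Module.Basis.constr_apply]
  exact Commute.sum_right _ _ _ fun s _ => (commute_shift_monomialField lam k s _).smul_right _

theorem ncoeff_monomialField_single_one (lam : ℂ) (k : ℕ) (m : ℤ) :
    ncoeff (monomialField lam k (Finsupp.single 1 1)) m = alpha lam k m := by
  have h : monomialField lam k (Finsupp.single 1 1) = listField lam k [1] := by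
    rw [monomialField]
    congr 1
    simp [Finsupp.toMultiset_single]
  rw [h, ← ncoeff_alphaField]
  exact nthProd_neg_one_idField (alphaField lam k) m

theorem ncoeff_Y_X_one (lam : ℂ) (k : ℕ) (m : ℤ) :
    ncoeff (Y lam k (MvPolynomial.X 1)) m = alpha lam k m := by
  rw [MvPolynomial.X, Y_list, ncoeff_monomialField_single_one]

theorem zeroMode_monomial (lam : ℂ) (k : ℕ) (s : ℕ+ →₀ ℕ) :
    zeroMode lam k (MvPolynomial.monomial s 1) =
      ncoeff (monomialField lam k s) (monomialWeight s - 1) := by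
  have := (MvPolynomial.basisMonomials ℕ+ ℂ).constr_basis ℂ
    (fun s => ncoeff (monomialField lam k s) (monomialWeight s - 1)) s
  rwa [MvPolynomial.coe_basisMonomials] at this

theorem zeroMode_X_one (lam : ℂ) (k : ℕ) : zeroMode lam k (MvPolynomial.X 1) = alpha lam k 0 := by
  rw [MvPolynomial.X, zeroMode_monomial, ncoeff_monomialField_single_one]
  congr 1
  simp [monomialWeight, Finsupp.toMultiset_single]

theorem zeroMode_one (lam : ℂ) (k : ℕ) : zeroMode lam k 1 = 1 := by
  have h : monomialField lam k 0 = idField := by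
    rw [monomialField, map_zero]
    have : (0 : Multiset ℕ+).sort (· ≥ ·) = [] := Multiset.sort_zero _
    rw [this]
    rfl
  have hw : monomialWeight 0 = 0 := by simp [monomialWeight]
  rw [show (1 : Fock) = MvPolynomial.monomial 0 1 from rfl, zeroMode_monomial, h, hw, ncoeff_idField, if_pos (by simp)]

theorem shift_pow_fockBasis (lam : ℂ) (k : ℕ) [NeZero k] (s : ℕ+ →₀ ℕ) (i : Fin k) (m : ℕ) :
    (shift lam k ^ m) (fockBasis lam k (s, i)) =
      if m ≤ i then fockBasis lam k (s, ⟨i - m, lt_of_le_of_lt (Nat.sub_le _ _) i.2⟩) else 0 := by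
  have hi := i.2
  rw [fockBasis_apply, shift_pow_tmul, jordanVector_eq, ← pow_add]
  split_ifs with h
  · rw [fockBasis_apply, jordanVector_eq]
    congr 4
    change _ = k - ((i : ℕ) - m + 1)
    lia
  · rw [pow_eq_zero_of_le (by lia) (omegaNil_pow lam k), tmul_zero, map_zero]

theorem isVertexSubmodule_range_shift_pow (lam : ℂ) (k m : ℕ) :
    IsVertexSubmodule lam k (LinearMap.range (shift lam k ^ m)) := by
  rintro v n _ ⟨w, rfl⟩
  exact ⟨ncoeff (Y lam k v) n w,
    LinearMap.congr_fun ((commute_shift_ncoeff_Y lam k v n).pow_left m) w⟩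

/-- The creation operators are modes of `X 1`, so every polynomial is built up from the vacuum
inside N. -/
theorem tmul_mem_of_isVertexSubmodule {lam : ℂ} {k : ℕ} {N : Submodule ℂ (FockModule lam k)}
    (hN : IsVertexSubmodule lam k N) {u : Omega lam k} (hu : toFock lam k (1 ⊗ₜ u) ∈ N)
    (p : Fock) : toFock lam k (p ⊗ₜ u) ∈ N := by
  induction p using MvPolynomial.induction_on with
  | C c =>
    rw [← mul_one (MvPolynomial.C c), ← MvPolynomial.smul_eq_C_mul, ← smul_tmul', map_smul]
    exact N.smul_mem c hu
  | add p q hp hq =>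
    rw [add_tmul, map_add]
    exact N.add_mem hp hq
  | mul_X p n hp =>
    have h := hN (MvPolynomial.X 1) (Int.negSucc n.natPred) _ hp
    rwa [ncoeff_Y_X_one, alpha_neg_tmul, PNat.succPNat_natPred, mul_comm] at h

/-- `W^{(j)}` is spanned by the vectors `α_{-n₁} ⋯ α_{-nᵣ} u_i` with `i ≤ j`. -/
theorem chain_eq_span (lam : ℂ) (k : ℕ) [NeZero k] {j : ℕ} (hj : j ≤ k) :
    chain lam k j = Submodule.span ℂ (fockBasis lam k '' {p | (p.2 : ℕ) < j}) := by
  apply le_antisymm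
  · have h1 : chain lam k j ≤ LinearMap.range (shift lam k ^ (k - j)) := by
      refine sInf_le ⟨isVertexSubmodule_range_shift_pow lam k _, fun i _ hi => ?_⟩
      refine ⟨_, (shift_pow_tmul lam k (k - j) 1 (omegaNil lam k ^ (j - i))).trans ?_⟩
      rw [← pow_add, jordanVector_eq]
      congr 3
      lia
    refine h1.trans ?_
    rw [LinearMap.range_eq_map, ← (fockBasis lam k).span_eq, Submodule.map_span_le]
    rintro _ ⟨⟨s, i⟩, rfl⟩
    have hi := i.2
    rw [shift_pow_fockBasis]
    split_ifs with h
    · refine Submodule.subset_span ⟨_, ?_, rfl⟩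
      change (i : ℕ) - (k - j) < j
      lia
    · exact Submodule.zero_mem _
  · refine Submodule.span_le.2 ?_
    rintro _ ⟨⟨s, i⟩, hi, rfl⟩
    refine Submodule.mem_sInf.2 fun N hN => ?_
    rw [fockBasis_apply]
    exact tmul_mem_of_isVertexSubmodule hN.1 (hN.2 _ (Nat.le_add_left _ _) hi) _

theorem fockBasis_repr (lam : ℂ) (k : ℕ) [NeZero k] (w : FockModule lam k) (s : ℕ+ →₀ ℕ)
    (i : Fin k) :
    (fockBasis lam k).repr w (s, i) = (jordanBasis lam k).repr (component lam k s w) i := by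
  have h : (fockBasis lam k).coord (s, i) = (jordanBasis lam k).coord i ∘ₗ component lam k s := by
    refine (fockBasis lam k).ext fun ⟨t, j⟩ => ?_
    rw [LinearMap.comp_apply, Module.Basis.coord_apply, Module.Basis.repr_self, fockBasis_apply,
      component_tmul, ← jordanBasis_apply, map_smul, Module.Basis.coord_apply,
      Module.Basis.repr_self, MvPolynomial.coeff_monomial]
    simp only [Finsupp.single_apply, Prod.mk.injEq, smul_eq_mul]
    split_ifs <;> simp_all
  exact LinearMap.congr_fun h w

/-! ### Monomial bases of the weight spaces, counted by partitions. -/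

/-- The exponents of the monomials in `W_μ`. -/
abbrev Level (a lam : ℂ) (μ : ℂ) : Type :=
  {s : ℕ+ →₀ ℕ // (monomialWeight s : ℂ) + (lam ^ 2 / 2 - a * lam) = μ}

theorem fockBasis_mem_weightSpace {a lam : ℂ} {k : ℕ} [NeZero k] {μ : ℂ} (s : Level a lam μ)
    (i : Fin k) : fockBasis lam k (s.1, i) ∈ weightSpace a lam k μ := by
  refine mem_weightSpace_iff.2 fun t ht => ?_
  rw [fockBasis_apply, component_tmul, MvPolynomial.coeff_monomial, if_neg, zero_smul]
  rintro rfl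
  exact ht s.2

/-- The monomial basis of `W_μ`. -/
def weightSpaceBasis {a lam : ℂ} (k : ℕ) [NeZero k] {μ : ℂ} {d : ℕ} (e : Fin d ≃ Level a lam μ) :
    Module.Basis (Fin k × Fin d) ℂ (weightSpace a lam k μ) :=
  Module.Basis.mk
    (v := fun p => ⟨fockBasis lam k ((e p.2).1, p.1), fockBasis_mem_weightSpace (e p.2) p.1⟩)
    (by
      refine LinearIndependent.of_comp (weightSpace a lam k μ).subtype ?_
      refine (fockBasis lam k).linearIndependent.comp (fun p : Fin k × Fin d => ((e p.2).1, p.1)) ?_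
      rintro ⟨i, s⟩ ⟨j, t⟩ h
      rw [Prod.mk.injEq] at h
      rw [Prod.mk.injEq]
      exact ⟨h.2, e.injective (Subtype.ext h.1)⟩)
    (by
      rintro ⟨w, hw⟩ -
      -- Spanning is checked in W, where vectors of W_μ have no coordinates at monomials of other
      -- weights.
      have h : w ∈ (Submodule.span ℂ (Set.range fun p : Fin k × Fin d =>
          (⟨fockBasis lam k ((e p.2).1, p.1), fockBasis_mem_weightSpace (e p.2) p.1⟩ :
            weightSpace a lam k μ))).map (weightSpace a lam k μ).subtype := by
        rw [Submodule.map_span]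
        refine Submodule.span_mono ?_ ((fockBasis lam k).mem_span_image (s := {p |
          (monomialWeight p.1 : ℂ) + (lam ^ 2 / 2 - a * lam) = μ}) |>.2 ?_)
        · rintro _ ⟨⟨s, i⟩, hs, rfl⟩
          exact ⟨_, ⟨(i, e.symm ⟨s, hs⟩), rfl⟩, by simp⟩
        · rintro ⟨s, i⟩ hs
          by_contra h
          refine Finsupp.mem_support_iff.1 hs ?_
          rw [fockBasis_repr, mem_weightSpace_iff.1 hw s h, map_zero, Finsupp.zero_apply]
      obtain ⟨w', hw', rfl⟩ := h
      exact hw')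

theorem weightSpaceBasis_apply {a lam : ℂ} (k : ℕ) [NeZero k] {μ : ℂ} {d : ℕ}
    (e : Fin d ≃ Level a lam μ) (p : Fin k × Fin d) :
    (weightSpaceBasis k e p : FockModule lam k) = fockBasis lam k ((e p.2).1, p.1) := by
  rw [weightSpaceBasis, Module.Basis.mk_apply]

theorem weightSpaceBasis_repr {a lam : ℂ} (k : ℕ) [NeZero k] {μ : ℂ} {d : ℕ}
    (e : Fin d ≃ Level a lam μ) (w : weightSpace a lam k μ) (p : Fin k × Fin d) :
    (weightSpaceBasis k e).repr w p = (fockBasis lam k).repr w ((e p.2).1, p.1) := by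
  have h : (weightSpaceBasis k e).coord p =
      (fockBasis lam k).coord ((e p.2).1, p.1) ∘ₗ (weightSpace a lam k μ).subtype := by
    refine (weightSpaceBasis k e).ext fun r => ?_
    rw [LinearMap.comp_apply, Submodule.subtype_apply, weightSpaceBasis_apply,
      Module.Basis.coord_apply, Module.Basis.coord_apply, Module.Basis.repr_self,
      Module.Basis.repr_self, Finsupp.single_apply, Finsupp.single_apply]
    congr 1
    rw [eq_iff_iff, Prod.ext_iff, Prod.ext_iff, Subtype.val_inj, e.apply_eq_iff_eq, and_comm]
  exact LinearMap.congr_fun h w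

/-- The exponents of weight `l` correspond to the partitions of `l`. -/
def exponentsToPartition (l : ℕ) (s : {s : ℕ+ →₀ ℕ // monomialWeight s = l}) :
    Nat.Partition l where
  parts := s.1.toMultiset.map fun n : ℕ+ => (n : ℕ)
  parts_pos := by
    intro i hi
    obtain ⟨n, _, rfl⟩ := Multiset.mem_map.1 hi
    exact n.pos
  parts_sum := by
    have h := s.2
    rw [monomialWeight] at h
    have h3 : ((s.1.toMultiset.map fun n : ℕ+ => (n : ℕ)).sum : ℤ) = l := by
      rw [Nat.cast_multiset_sum, Multiset.map_map]
      exact h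
    exact_mod_cast h3

theorem exponentsToPartition_bijective (l : ℕ) : Function.Bijective (exponentsToPartition l) := by
  constructor
  · intro s t h
    have h' := congrArg Nat.Partition.parts h
    exact Subtype.ext (Multiset.toFinsupp.symm.injective
      (Multiset.map_injective PNat.coe_injective h'))
  · intro p
    -- Positivity of the parts lifts the multiset to ℕ+.
    obtain ⟨m, hm⟩ : ∃ m : Multiset ℕ+, m.map (fun n : ℕ+ => (n : ℕ)) = p.parts :=
      CanLift.prf p.parts fun _ hi => p.parts_pos hi
    refine ⟨⟨Multiset.toFinsupp m, ?_⟩, ?_⟩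
    · rw [monomialWeight, Multiset.toFinsupp_toMultiset, ← p.parts_sum, ← hm,
        Nat.cast_multiset_sum, Multiset.map_map]
      rfl
    · refine Nat.Partition.ext ?_
      change (Multiset.map _ (Finsupp.toMultiset (Multiset.toFinsupp m))) = _
      rw [Multiset.toFinsupp_toMultiset, hm]

theorem monomialWeight_nonneg (s : ℕ+ →₀ ℕ) : 0 ≤ monomialWeight s := by
  rw [monomialWeight_eq_sum]
  positivity

theorem nonempty_level_equiv (a lam : ℂ) (l : ℕ) :
    Nonempty (Fin (Fintype.card (Nat.Partition l)) ≃
      Level a lam (lam ^ 2 / 2 - a * lam + l)) := by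
  refine ⟨(Fintype.equivFin _).symm.trans
    ((Equiv.ofBijective _ (exponentsToPartition_bijective l)).symm.trans
      (Equiv.subtypeEquivRight fun s => ?_))⟩
  rw [add_comm (_ - _), add_left_inj]
  exact_mod_cast Iff.rfl

theorem isEmpty_level {a lam μ : ℂ} (h : ∀ l : ℕ, lam ^ 2 / 2 - a * lam + l ≠ μ) :
    IsEmpty (Level a lam μ) := by
  refine ⟨fun s => h (monomialWeight s.1).toNat ?_⟩
  have h1 : ((monomialWeight s.1).toNat : ℤ) = monomialWeight s.1 :=
    Int.toNat_of_nonneg (monomialWeight_nonneg s.1)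
  have h2 : ((monomialWeight s.1).toNat : ℂ) = (monomialWeight s.1 : ℂ) := by exact_mod_cast h1
  rw [h2, add_comm]
  exact s.2

theorem exists_level_equiv (a lam μ : ℂ) : ∃ d : ℕ, Nonempty (Fin d ≃ Level a lam μ) := by
  by_cases h : ∃ l : ℕ, lam ^ 2 / 2 - a * lam + l = μ
  · obtain ⟨l, rfl⟩ := h
    exact ⟨_, nonempty_level_equiv a lam l⟩
  -- Here W_μ = 0, and an empty basis with block size 0 serves.
  · have := isEmpty_level (not_exists.1 h)
    exact ⟨0, ⟨Equiv.equivOfIsEmpty _ _⟩⟩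

end FreeBoson

end

/-! ### Block Toeplitz matrices and strongly interlocked bases. -/

noncomputable section

namespace FreeBoson

open VertexOperator TensorProduct

/-- The matrix of `k × k` blocks of size `d × d` with identity blocks above the diagonal. -/
def superdiagonal (k d : ℕ) : Matrix (Fin k × Fin d) (Fin k × Fin d) ℂ :=
  Matrix.of fun p r => if (p.1 : ℕ) + 1 = r.1 ∧ p.2 = r.2 then 1 else 0

section Superdiagonal

variable {k d : ℕ} (M : Matrix (Fin k × Fin d) (Fin k × Fin d) ℂ)

/-- Right multiplication by the superdiagonal moves block columns one step right and leaves a zero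
first column; left multiplication moves block rows one step up. The next lemmas record these
entries. -/
theorem mul_superdiagonal_succ (p : Fin k × Fin d) {j j' : Fin k} (h : (j' : ℕ) + 1 = j)
    (t : Fin d) : (M * superdiagonal k d) p (j, t) = M p (j', t) := by
  rw [Matrix.mul_apply, Finset.sum_eq_single (j', t)]
  · simp [superdiagonal, h]
  · rintro ⟨i, s⟩ _ hne
    rw [superdiagonal, Matrix.of_apply, if_neg, mul_zero]
    rintro ⟨h1, h2⟩
    exact hne (Prod.ext (Fin.ext (by change (i : ℕ) + 1 = j at h1; lia)) h2)
  · exact fun h => absurd (Finset.mem_univ _) h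

theorem mul_superdiagonal_zero (p : Fin k × Fin d) {j : Fin k} (h : (j : ℕ) = 0)
    (t : Fin d) : (M * superdiagonal k d) p (j, t) = 0 := by
  rw [Matrix.mul_apply]
  refine Finset.sum_eq_zero fun r _ => ?_
  rw [superdiagonal, Matrix.of_apply, if_neg, mul_zero]
  rintro ⟨h1, -⟩
  change _ = (j : ℕ) at h1
  lia

theorem superdiagonal_mul_succ {i i' : Fin k} (h : (i : ℕ) + 1 = i') (s : Fin d)
    (q : Fin k × Fin d) : (superdiagonal k d * M) (i, s) q = M (i', s) q := by
  rw [Matrix.mul_apply, Finset.sum_eq_single (i', s)]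
  · simp [superdiagonal, h]
  · rintro ⟨j, t⟩ _ hne
    rw [superdiagonal, Matrix.of_apply, if_neg, zero_mul]
    rintro ⟨h1, h2⟩
    exact hne (Prod.ext (Fin.ext (by change (i : ℕ) + 1 = j at h1; lia)) h2.symm)
  · exact fun h => absurd (Finset.mem_univ _) h

theorem superdiagonal_pow_apply (m : ℕ) (p r : Fin k × Fin d) :
    (superdiagonal k d ^ m) p r = if (p.1 : ℕ) + m = r.1 ∧ p.2 = r.2 then 1 else 0 := by
  induction m generalizing r with
  | zero => simp [Matrix.one_apply, Prod.ext_iff, Fin.ext_iff]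
  | succ m ih =>
    obtain ⟨j, t⟩ := r
    rw [pow_succ]
    by_cases hj : (j : ℕ) = 0
    · rw [mul_superdiagonal_zero _ _ hj, if_neg]
      rintro ⟨h, -⟩
      change _ = (j : ℕ) at h
      lia
    · have hj' : ((⟨j - 1, by lia⟩ : Fin k) : ℕ) + 1 = j := Nat.sub_add_cancel (by lia)
      rw [mul_superdiagonal_succ _ _ hj', ih]
      refine if_congr (and_congr_left' ?_) rfl rfl
      change (p.1 : ℕ) + m = j - 1 ↔ (p.1 : ℕ) + (m + 1) = j
      lia

variable {M}

/-- Comparing blocks (i, j + 1) of the two products gives equality of blocks (i, j) and (i + 1, j +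
1); iterate n times. -/
theorem block_toeplitz_of_commute (h : Commute M (superdiagonal k d)) (n : ℕ)
    {i j i' j' : Fin k} (hi : (i : ℕ) + n = i') (hj : (j : ℕ) + n = j') (s t : Fin d) :
    M (i, s) (j, t) = M (i', s) (j', t) := by
  induction n generalizing i' j' with
  | zero =>
    obtain rfl : i = i' := Fin.ext hi
    obtain rfl : j = j' := Fin.ext hj
    rfl
  | succ n ih =>
    have hi1 : ((⟨i + n, by have := i'.2; lia⟩ : Fin k) : ℕ) + 1 = i' := hi
    have hj1 : ((⟨j + n, by have := j'.2; lia⟩ : Fin k) : ℕ) + 1 = j' := hj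
    rw [ih (i' := ⟨i + n, by lia⟩) (j' := ⟨j + n, by lia⟩) rfl rfl, ← mul_superdiagonal_succ M _ hj1, h.eq, superdiagonal_mul_succ M hi1]

/-- Blocks are constant along diagonals, which gives `diag` and `outer`. For `upper`, slide a block
below the diagonal to the first block column, which vanishes below its top block since that of `M *
superdiagonal k d` is zero. -/
theorem isInterlockedForm_of_commute [NeZero k] (h : Commute M (superdiagonal k d)) :
    IsInterlockedForm M where
  upper i j hij s t := by
    have hij' : (j : ℕ) < i := hij
    have hi := i.2
    have h1 : ((⟨i - j - 1, by lia⟩ : Fin k) : ℕ) + 1 = (⟨i - j, by lia⟩ : Fin k) :=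
      Nat.sub_add_cancel (by lia)
    rw [← block_toeplitz_of_commute h j (i := ⟨i - j, by lia⟩) (j := 0)
      (Nat.sub_add_cancel hij'.le) (by simp), ← superdiagonal_mul_succ M h1, ← h.eq,
      mul_superdiagonal_zero M _ (by simp)]
  diag i s t := (block_toeplitz_of_commute h i (by simp) (by simp) s t).symm
  outer j s t := by
    have hj := j.2
    -- Moving k - 1 - j steps down the diagonal takes block column j to the last one.
    refine block_toeplitz_of_commute h (k - 1 - j) ?_ ?_ s t
    · rw [Fin.val_rev, Fin.val_zero]; lia
    · rw [Fin.val_rev, Fin.val_zero]; lia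

end Superdiagonal

/-- `(α_0 - λ)|_{W_μ}`. -/
def shiftAt (a lam : ℂ) (k : ℕ) (μ : ℂ) : Module.End ℂ (weightSpace a lam k μ) :=
  zeroModeAt a lam k μ (MvPolynomial.X 1) - lam • 1

theorem coe_shiftAt (a lam : ℂ) (k : ℕ) (μ : ℂ) (w : weightSpace a lam k μ) :
    (shiftAt a lam k μ w : FockModule lam k) = shift lam k w := by
  have h : ((zeroModeAt a lam k μ (MvPolynomial.X 1) w : weightSpace a lam k μ) :
      FockModule lam k) = alpha lam k 0 w := by rw [← zeroMode_X_one]; rfl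
  rw [shiftAt, shift, LinearMap.sub_apply, LinearMap.sub_apply, ← h]
  rfl

theorem commute_shiftAt_zeroModeAt (a lam : ℂ) (k : ℕ) (μ : ℂ) (v : Fock) :
    Commute (shiftAt a lam k μ) (zeroModeAt a lam k μ v) := by
  refine LinearMap.ext fun w => Subtype.ext ?_
  rw [Module.End.mul_apply, Module.End.mul_apply, coe_shiftAt]
  change _ = zeroMode lam k v (shiftAt a lam k μ w : FockModule lam k)
  rw [coe_shiftAt]
  exact LinearMap.congr_fun (commute_shift_zeroMode lam k v) w

/-- The centralizer of α_0 - λ is a subalgebra containing all zero modes. -/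
theorem commute_shiftAt_of_mem_adjoin {a lam : ℂ} {k : ℕ} {μ : ℂ}
    {σ : Module.End ℂ (weightSpace a lam k μ)}
    (hσ : σ ∈ Algebra.adjoin ℂ (Set.range (zeroModeAt a lam k μ))) :
    Commute (shiftAt a lam k μ) σ := by
  have h : Algebra.adjoin ℂ (Set.range (zeroModeAt a lam k μ)) ≤
      Subalgebra.centralizer ℂ {shiftAt a lam k μ} := by
    refine Algebra.adjoin_le ?_
    rintro _ ⟨v, rfl⟩
    refine Subalgebra.mem_centralizer_iff ℂ |>.2 fun x hx => ?_
    rw [Set.mem_singleton_iff.1 hx]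
    exact commute_shiftAt_zeroModeAt a lam k μ v
  exact Subalgebra.mem_centralizer_iff ℂ |>.1 (h hσ) _ rfl

theorem toMatrix_shiftAt {a lam : ℂ} {k d : ℕ} [NeZero k] {μ : ℂ}
    (e : Fin d ≃ Level a lam μ) :
    LinearMap.toMatrix (weightSpaceBasis k e) (weightSpaceBasis k e) (shiftAt a lam k μ) =
      superdiagonal k d := by
  ext p ⟨j, t⟩
  rw [LinearMap.toMatrix_apply, weightSpaceBasis_repr, coe_shiftAt, weightSpaceBasis_apply,
    ← pow_one (shift lam k), shift_pow_fockBasis, superdiagonal, Matrix.of_apply]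
  split_ifs with h1 h2 h2
  · rw [Module.Basis.repr_self, Finsupp.single_apply, if_pos]
    refine Prod.ext (congrArg (fun t => (e t).1) h2.2.symm) (Fin.ext ?_)
    exact Nat.sub_eq_of_eq_add h2.1.symm
  · rw [Module.Basis.repr_self, Finsupp.single_apply, if_neg]
    intro h
    obtain ⟨h3, h4⟩ := Prod.ext_iff.1 h
    refine h2 ⟨?_, (e.injective (Subtype.ext h3)).symm⟩
    have h5 : (j : ℕ) - 1 = p.1 := congrArg Fin.val h4
    change (p.1 : ℕ) + 1 = j
    change 1 ≤ (j : ℕ) at h1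
    lia
  · have h3 : (p.1 : ℕ) + 1 = j := h2.1
    exact absurd (by change 1 ≤ (j : ℕ); lia) h1
  · simp

theorem toMatrix_zeroModeAt_X_one {a lam : ℂ} {k d : ℕ} {μ : ℂ}
    (b : Module.Basis (Fin k × Fin d) ℂ (weightSpace a lam k μ)) :
    LinearMap.toMatrix b b (zeroModeAt a lam k μ (MvPolynomial.X 1)) =
      LinearMap.toMatrix b b (shiftAt a lam k μ) + lam • 1 := by
  rw [shiftAt, map_sub, map_smul, LinearMap.toMatrix_one, sub_add_cancel]

theorem superdiagonal_add_smul_one (k d : ℕ) (lam : ℂ) : superdiagonal k d + lam • 1 =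
    Matrix.of fun p r : Fin k × Fin d => (if p = r then lam else 0) +
      if (p.1 : ℕ) + 1 = r.1 ∧ p.2 = r.2 then 1 else 0 := by
  ext p r
  rw [Matrix.add_apply, Matrix.smul_apply, Matrix.one_apply, add_comm, superdiagonal,
    Matrix.of_apply, Matrix.of_apply, smul_ite, smul_zero, smul_eq_mul, mul_one]

/-- The monomial basis of `W_μ` is strongly interlocked. -/
def monomialInterlockedBasis {a lam : ℂ} (k : ℕ) [NeZero k] {d : ℕ} {μ : ℂ}
    (e : Fin d ≃ Level a lam μ) : StronglyInterlockedBasis a lam k μ where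
  d := d
  basis := weightSpaceBasis k e
  span_eq j hj := by
    ext w
    rw [Submodule.mem_comap, chain_eq_span lam k hj, Module.Basis.mem_span_image,
      Module.Basis.mem_span_image, Submodule.subtype_apply]
    constructor
    · rintro h ⟨s, i⟩ hs
      by_cases hl : (monomialWeight s : ℂ) + (lam ^ 2 / 2 - a * lam) = μ
      · refine h (a := (i, e.symm ⟨s, hl⟩)) ?_
        rw [Finset.mem_coe, Finsupp.mem_support_iff, weightSpaceBasis_repr, e.apply_symm_apply]
        exact Finsupp.mem_support_iff.1 hs
      -- Coordinates at monomials outside the level of μ vanish on W_μ, so they impose no condition.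
      · refine absurd ?_ (Finsupp.mem_support_iff.1 hs)
        rw [fockBasis_repr, mem_weightSpace_iff.1 w.2 s hl, map_zero, Finsupp.zero_apply]
    · intro h p hp
      rw [Finset.mem_coe, Finsupp.mem_support_iff, weightSpaceBasis_repr] at hp
      exact h (a := ((e p.2).1, p.1)) (Finsupp.mem_support_iff.2 hp)
  form σ hσ := by
    refine isInterlockedForm_of_commute ?_
    rw [← toMatrix_shiftAt e]
    change _ * _ = _ * _
    rw [← LinearMap.toMatrix_mul, ← LinearMap.toMatrix_mul,
      (commute_shiftAt_of_mem_adjoin hσ).eq]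
  alpha_zero := by
    rw [toMatrix_zeroModeAt_X_one, toMatrix_shiftAt, superdiagonal_add_smul_one]

/-- Compare components: those off the level of μ vanish, and on the others the scalar part of L_0 is
exactly μ. -/
theorem nilpotentPart_eq (a lam : ℂ) (k : ℕ) [NeZero k] (μ : ℂ) :
    nilpotentPart a lam k μ =
      shiftAt a lam k μ * ((1 / 2 : ℂ) • shiftAt a lam k μ + (lam - a) • 1) := by
  refine LinearMap.ext fun w => Subtype.ext ?_
  rw [Module.End.mul_apply, coe_shiftAt]
  change L0 a lam k w - μ • (w : FockModule lam k) = shift lam k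
    ((1 / 2 : ℂ) • (shiftAt a lam k μ w : FockModule lam k) + (lam - a) • (w : FockModule lam k))
  rw [coe_shiftAt, ← sub_eq_zero]
  refine eq_zero_of_component fun s => ?_
  simp only [map_sub, map_add, map_smul, component_L0, component_shift]
  by_cases hs : (monomialWeight s : ℂ) + (lam ^ 2 / 2 - a * lam) = μ
  · generalize component lam k s w = c
    rw [← hs]
    simp only [Algebra.algebraMap_eq_smul_one, add_mul, sub_mul, smul_mul_assoc, one_mul,
      pow_two, mul_assoc]
    module
  · simp [mem_weightSpace_iff.1 w.2 s hs]

/-! ### Pseudo-traces of powers of the nilpotent part. -/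

section PseudoTrace

variable {a lam : ℂ} {k : ℕ} [NeZero k] {μ : ℂ} (b : StronglyInterlockedBasis a lam k μ)

theorem pstr_eq_sum (σ : Module.End ℂ (weightSpace a lam k μ)) :
    pstr b σ = ∑ s, LinearMap.toMatrix b.basis b.basis σ (0, s) (Fin.rev 0, s) := rfl

theorem pstr_smul (c : ℂ) (σ : Module.End ℂ (weightSpace a lam k μ)) :
    pstr b (c • σ) = c * pstr b σ := by
  simp [pstr_eq_sum, Finset.mul_sum]

theorem pstr_sum {ι : Type*} (u : Finset ι) (σ : ι → Module.End ℂ (weightSpace a lam k μ)) :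
    pstr b (∑ i ∈ u, σ i) = ∑ i ∈ u, pstr b (σ i) := by
  simp only [pstr_eq_sum, map_sum, Matrix.sum_apply]
  exact Finset.sum_comm

/-- This uses only the normalization of the basis by α_0, and it makes pseudo-traces of polynomials
in α_0 - λ independent of the basis. -/
theorem toMatrix_shiftAt_eq_superdiagonal :
    LinearMap.toMatrix b.basis b.basis (shiftAt a lam k μ) = superdiagonal k b.d := by
  have h := b.alpha_zero
  rw [toMatrix_zeroModeAt_X_one, ← superdiagonal_add_smul_one] at h
  exact add_right_cancel h

/-- The m-th power of the shift has identity blocks on the m-th superdiagonal, which meets the upper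
right block only for m = k - 1. -/
theorem pstr_shiftAt_pow (m : ℕ) :
    pstr b (shiftAt a lam k μ ^ m) = if m = k - 1 then (b.d : ℂ) else 0 := by
  rw [pstr_eq_sum, ← LinearMap.toMatrix_pow, toMatrix_shiftAt_eq_superdiagonal]
  simp only [superdiagonal_pow_apply, Fin.val_zero, Fin.val_rev, zero_add, and_true]
  split_ifs <;> simp

/-- Expand N^j((λ - a) + N/2)^j and keep the coefficient of N^{k-1}. -/
theorem pstr_nilpotentPart_pow (j : ℕ) : pstr b (nilpotentPart a lam k μ ^ j) =
    if k ≤ 2 * j + 1 ∧ j ≤ k - 1 then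
      (j.choose (k - j - 1) : ℂ) * (1 / 2 : ℂ) ^ (k - 1 - j) * (lam - a) ^ (2 * j + 1 - k) * b.d
    else 0 := by
  have hk : 1 ≤ k := NeZero.one_le
  have h : nilpotentPart a lam k μ ^ j = ∑ i ∈ Finset.range (j + 1),
      ((1 / 2 : ℂ) ^ i * (lam - a) ^ (j - i) * (j.choose i : ℂ)) • shiftAt a lam k μ ^ (j + i) := by
    rw [nilpotentPart_eq, Commute.mul_pow, Commute.add_pow, Finset.mul_sum]
    · refine Finset.sum_congr rfl fun i _ => ?_
      rw [smul_pow, smul_pow, one_pow, pow_add, ← nsmul_eq_mul', ← Nat.cast_smul_eq_nsmul ℂ]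
      simp only [mul_smul_comm, smul_smul, mul_one]
      congr 1
      ring
    · exact (Commute.one_right _).smul_right _
    · exact ((Commute.refl _).smul_right _).add_right ((Commute.one_right _).smul_right _)
  rw [h, pstr_sum]
  simp only [pstr_smul, pstr_shiftAt_pow]
  split_ifs with hj
  -- The exponent j + i equals k - 1 only at i = k - 1 - j, and 0 ≤ i ≤ j is the condition on j.
  · rw [Finset.sum_eq_single (k - 1 - j), if_pos (by lia), show j - (k - 1 - j) = 2 * j + 1 - k by lia,
      show k - j - 1 = k - 1 - j by lia]
    · ring
    · intro i _ hi
      rw [if_neg (by lia), mul_zero]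
    · intro hi
      exact absurd (Finset.mem_range.2 (by lia)) hi
  · refine Finset.sum_eq_zero fun i hi => ?_
    have := Finset.mem_range.1 hi
    rw [if_neg (by lia), mul_zero]

/-- Both bases have k times the block size many elements, and k ≠ 0. -/
theorem StronglyInterlockedBasis.d_eq {d : ℕ} (e : Fin d ≃ Level a lam μ) : b.d = d := by
  have h1 := Module.finrank_eq_card_basis b.basis
  rw [Module.finrank_eq_card_basis (weightSpaceBasis k e)] at h1
  simp only [Fintype.card_prod, Fintype.card_fin] at h1
  exact (Nat.eq_of_mul_eq_mul_left (NeZero.pos k) h1).symm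

end PseudoTrace

/-! ### Summation of the graded pseudo-trace. -/

/-- The coefficient of `(log q)^j / j!` in the graded pseudo-trace, times that power. -/
def logTerm (a lam : ℂ) (k : ℕ) (τ : UpperHalfPlane) (j : ℕ) : ℂ :=
  1 / (j.factorial : ℂ) * (j.choose (k - j - 1) : ℂ) * (2 : ℂ) ^ (-(k : ℤ) + j + 1) *
    (lam - a) ^ (2 * (j : ℤ) - k + 1) * logq τ ^ j

theorem mem_Icc_ceil_iff (k j : ℕ) :
    j ∈ Finset.Icc ⌈((k : ℝ) - 1) / 2⌉₊ (k - 1) ↔ k ≤ 2 * j + 1 ∧ j ≤ k - 1 := by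
  rw [Finset.mem_Icc, Nat.ceil_le, div_le_iff₀ two_pos, sub_le_iff_le_add, mul_comm]
  refine and_congr_left' ?_
  exact_mod_cast Iff.rfl

theorem zeroModeAt_one (a lam : ℂ) (k : ℕ) (μ : ℂ) : zeroModeAt a lam k μ 1 = 1 := by
  refine LinearMap.ext fun w => Subtype.ext ?_
  change zeroMode lam k 1 w = w
  rw [zeroMode_one, Module.End.one_apply]

theorem gradedPseudoTraceTerm_one {a lam : ℂ} {k : ℕ} [NeZero k]
    (b : ∀ μ : ℂ, StronglyInterlockedBasis a lam k μ) (τ : UpperHalfPlane) (μ : ℂ) (j : ℕ) :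
    gradedPseudoTraceTerm b 1 τ (μ, j) = ((b μ).d : ℂ) *
      (if j ∈ Finset.Icc ⌈((k : ℝ) - 1) / 2⌉₊ (k - 1) then logTerm a lam k τ j else 0) *
      qPow τ (μ - centralCharge a / 24) := by
  have hk : 1 ≤ k := NeZero.one_le
  rw [gradedPseudoTraceTerm]
  dsimp only
  rw [zeroModeAt_one, one_mul, pstr_smul, pstr_nilpotentPart_pow]
  simp only [mem_Icc_ceil_iff]
  congr 1
  split_ifs with h
  -- In this range the integer exponents are, up to sign, honest natural differences, so 0^0 = 1
  -- agrees on both sides.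
  · have h1 : (-(k : ℤ) + j + 1) = -((k - 1 - j : ℕ) : ℤ) := by lia
    have h2 : (2 * (j : ℤ) - k + 1) = ((2 * j + 1 - k : ℕ) : ℤ) := by lia
    rw [logTerm, h1, h2, zpow_natCast, zpow_neg, zpow_natCast, one_div_pow, one_div ((2 : ℂ) ^ _)]
    ring
  · ring

/-- The term a²/2 from -c/24 completes the square. -/
theorem qPow_weight (a lam : ℂ) (τ : UpperHalfPlane) (l : ℕ) :
    qPow τ (lam ^ 2 / 2 - a * lam + l - centralCharge a / 24) =
      qPow τ ((lam - a) ^ 2 / 2 - 1 / 24) * qPow τ l := by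
  rw [← qPow_add, centralCharge]
  congr 1
  ring

/-- The family lives on the pairs (λ²/2 - aλ + ℓ, j), where it is a product of a function of ℓ and
one of j. -/
theorem hasSum_gradedPseudoTraceTerm {a lam : ℂ} {k : ℕ} [NeZero k]
    (b : ∀ μ : ℂ, StronglyInterlockedBasis a lam k μ) (τ : UpperHalfPlane) :
    HasSum (gradedPseudoTraceTerm b 1 τ) (qPow τ ((lam - a) ^ 2 / 2 - 1 / 24) *
      ((∑' l : ℕ, qPow τ l * (Fintype.card (Nat.Partition l) : ℂ)) *
        ∑ j ∈ Finset.Icc ⌈((k : ℝ) - 1) / 2⌉₊ (k - 1), logTerm a lam k τ j)) := by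
  have hinj : Function.Injective fun p : ℕ × ℕ => ((lam ^ 2 / 2 - a * lam + p.1 : ℂ), p.2) := by
    rintro ⟨l, j⟩ ⟨l', j'⟩ h
    obtain ⟨h1, h2⟩ := Prod.ext_iff.1 h
    exact Prod.ext (Nat.cast_injective (add_left_cancel h1)) h2
  rw [← hinj.hasSum_iff]
  · have hf := summable_norm_qPow_mul_card_partition τ
    -- Extending the finite sum over j by zero makes the double sum a product of two absolutely
    -- convergent series.
    set g : ℕ → ℂ := fun j =>
      if j ∈ Finset.Icc ⌈((k : ℝ) - 1) / 2⌉₊ (k - 1) then logTerm a lam k τ j else 0 with hg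
    have hg0 : ∀ j ∉ Finset.Icc ⌈((k : ℝ) - 1) / 2⌉₊ (k - 1), g j = 0 := fun j hj => if_neg hj
    have hgs : Summable fun j => ‖g j‖ := (summable_of_ne_finset_zero hg0).norm
    have hgt : ∑' j, g j = ∑ j ∈ Finset.Icc ⌈((k : ℝ) - 1) / 2⌉₊ (k - 1), logTerm a lam k τ j := by
      rw [tsum_eq_sum hg0]
      exact Finset.sum_congr rfl fun j hj => if_pos hj
    rw [← hgt, tsum_mul_tsum_of_summable_norm hf hgs]
    refine Eq.mp (congrArg (HasSum · _) (funext fun p => ?_))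
      ((summable_mul_of_summable_norm hf hgs).hasSum.mul_left _)
    obtain ⟨e⟩ := nonempty_level_equiv a lam p.1
    rw [Function.comp_apply, gradedPseudoTraceTerm_one, qPow_weight,
      StronglyInterlockedBasis.d_eq _ e]
    ring
  · rintro ⟨μ, j⟩ hμ
    -- Off the image the block size is 0, so the term vanishes.
    have he : IsEmpty (Level a lam μ) := isEmpty_level fun l hl =>
      hμ ⟨(l, j), Prod.ext hl rfl⟩
    rw [gradedPseudoTraceTerm_one,
      StronglyInterlockedBasis.d_eq (b μ) (Equiv.equivOfIsEmpty (Fin 0) _)]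
    simp

end FreeBoson

end

theorem theorem4 (a lam : ℂ) (k : ℕ) [NeZero k] :
    (∀ μ : ℂ, Nonempty (FreeBoson.StronglyInterlockedBasis a lam k μ)) ∧
    ∀ (b : ∀ μ : ℂ, FreeBoson.StronglyInterlockedBasis a lam k μ) (τ : UpperHalfPlane),
      Summable (FreeBoson.gradedPseudoTraceTerm b 1 τ) ∧
      Summable (fun l : ℕ => FreeBoson.qPow τ l * (Fintype.card (Nat.Partition l) : ℂ) *
        ∑ j ∈ Finset.Icc ⌈((k : ℝ) - 1) / 2⌉₊ (k - 1),
          1 / (j.factorial : ℂ) * (j.choose (k - j - 1) : ℂ) * (2 : ℂ) ^ (-(k : ℤ) + j + 1) *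
            (lam - a) ^ (2 * (j : ℤ) - k + 1) * FreeBoson.logq τ ^ j) ∧
      FreeBoson.gradedPseudoTrace b 1 τ =
        FreeBoson.qPow τ ((lam - a) ^ 2 / 2 - 1 / 24) *
          ∑' l : ℕ, FreeBoson.qPow τ l * (Fintype.card (Nat.Partition l) : ℂ) *
            ∑ j ∈ Finset.Icc ⌈((k : ℝ) - 1) / 2⌉₊ (k - 1),
              1 / (j.factorial : ℂ) * (j.choose (k - j - 1) : ℂ) * (2 : ℂ) ^ (-(k : ℤ) + j + 1) *
                (lam - a) ^ (2 * (j : ℤ) - k + 1) * FreeBoson.logq τ ^ j ∧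
      FreeBoson.gradedPseudoTrace b 1 τ =
        FreeBoson.qPow τ ((lam - a) ^ 2 / 2) * (ModularForm.eta τ)⁻¹ *
          ∑ j ∈ Finset.Icc ⌈((k : ℝ) - 1) / 2⌉₊ (k - 1),
            1 / (j.factorial : ℂ) * (j.choose (k - j - 1) : ℂ) * (2 : ℂ) ^ (-(k : ℤ) + j + 1) *
              (lam - a) ^ (2 * (j : ℤ) - k + 1) * FreeBoson.logq τ ^ j := by
  refine ⟨fun μ => ?_, fun b τ => ?_⟩
  · obtain ⟨d, ⟨e⟩⟩ := FreeBoson.exists_level_equiv a lam μ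
    exact ⟨FreeBoson.monomialInterlockedBasis k e⟩
  · have h := FreeBoson.hasSum_gradedPseudoTraceTerm b τ
    have hs := (FreeBoson.summable_norm_qPow_mul_card_partition τ).of_norm
    refine ⟨h.summable, hs.mul_right _, ?_, ?_⟩
    · rw [tsum_mul_right]
      exact h.tsum_eq
    · rw [← FreeBoson.qPow_mul_tsum_card_partition, ← mul_assoc, ← FreeBoson.qPow_add,
        show (lam - a) ^ 2 / 2 + -1 / 24 = (lam - a) ^ 2 / 2 - 1 / 24 by ring, mul_assoc]
      exact h.tsum_eq
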